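/- **Setting.** Let $0<\gamma<1$, $T>0$, and let $T_e>0$ satisfy the sampling condition $\frac{1}{2T_e}>\frac{1+\gamma}{2T}$ and $T_e\notin\{T,\frac T2,\frac T3,\frac{2T}3\}$. Put $\mathcal B=[-\frac{1+\gamma}{2T},\frac{1+\gamma}{2T}]$ and $\alpha=T_e/T$, and let $\mathcal F(\mathcal B)$ be the set of $f_a\in L^2(\mathbb R)$ of the form $f_a(t)=\int_{\mathcal B}e^{2i\pi\nu t}\hat f_a(\nu)\,d\nu$ with $\hat f_a\in L^2(\mathcal B)$. Let $(a_n)_{n\in\mathbb Z}$ be i.i.d. symbols with values $\pm1$, each with probability $\frac12$. Let $g_a\in\mathcal F(\mathcal B)$ be a shaping filter whose Fourier transform is nonzero almost everywhere on $\mathcal B$, and let $s(n)=s_a(nT_e)$, where $s_a(t)=\sum_n a_n g_a(t-nT)$ (convergence in mean square). For a sequence $(u_n)_{n\in\mathbb Z}$ write $\langle u_n\rangle=\lim_{N\to\infty}\frac1{2N+1}\sum_{n=-N}^N u_n$. For a sequence $x(n)$ of random variables put $$R_x^{(\theta)}(0)=\langle\mathbb E(x(n)x(n)^*)e^{-2i\pi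 n\theta}\rangle,\quad R_{c,x}^{(\theta)}(0)=\langle\mathbb E(x(n)^2)e^{-2i\pi n\theta}\rangle,\quad c_4(x)=\mathrm{cum}(x,x^*,x,x^*),$$ $$\beta(x)=\langle c_4(x(n))\rangle+2+2\sum_{l=\pm1}|R_x^{(l\alpha)}(0)|^2+\sum_{l=-1,0,1}|R_{c,x}^{(l\alpha)}(0)|^2 .$$ The norm of a filter with (measurable) transfer function $f$ is given by $\|f\|^2=\int_{-1/2}^{1/2}|f(e^{2i\pi\nu})|^2S_s^{(0)}(e^{2i\pi\nu})\,d\nu$, where $S_s^{(0)}$ is the spectral density of $s$, i.e. $\langle\mathbb E(s(n+m)s(n)^*)\rangle=\int_{-1/2}^{1/2}S_s^{(0)}(e^{2i\pi\nu})e^{2i\pi m\nu}d\nu$ for all $m\in\mathbb Z$. The output $[f(z)]s(n)$ is the mean-square limit of the outputs of finite impulse response filters that converge to $f$ in this norm. Put $$\beta_{\min}=\inf_{\|f\|=1}\beta([f(z)]s(n)),\qquad \eta_{\min}=\inf_{\|f\|=1}\langle c_4([f(z)]s(n))\rangle .$$ **Proposition.** The kurtosis $\kappa=c_4(a_n)$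 of the symbols equals $-2$. Every filter of finite norm has a well-defined output; for every filter of norm $1$ the output has finite fourth moments and the time averages that occur in $\beta$ exist. Moreover $\beta_{\min}$ and $\eta_{\min}$ are finite, $$\beta_{\min}=\inf_{f_a\in\mathcal F(\mathcal B),\,f_a\ne0}\Phi(f_a),\qquad \eta_{\min}=\inf_{f_a\in\mathcal F(\mathcal B),\,f_a\neq0}\kappa T\,\frac{\int_{\mathbb R}|f_a|^4dt}{\left(\int_{\mathbb R}|f_a|^2dt\right)^2},$$ where $$\Phi(f_a)=\kappa T\frac{\int_{\mathbb R}|f_a|^4dt}{\left(\int_{\mathbb R}|f_a|^2dt\right)^2}+2+4\left|\frac{\int_{\mathbb R}|f_a|^2e^{-2i\pi t/T}dt}{\int_{\mathbb R}|f_a|^2dt}\right|^2+\frac{\left|\int_{\mathbb R}f_a^2dt\right|^2+\left|\int_{\mathbb R}f_a^2e^{-2i\pi t/T}dt\right|^2+\left|\int_{\mathbb R}f_a^2e^{2i\pi t/T}dt\right|^2}{\left(\int_{\mathbb R}|f_a|^2dt\right)^2}.$$ -/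

import Mathlib

open MeasureTheory ProbabilityTheory Filter Topology
open scoped ENNReal ComplexConjugate

noncomputable section

namespace BPSK

/-! ### Band-limited functions -/

/-- `h` is the Fourier transform of the square integrable function `f`, and it vanishes outside the
(bounded) band `B`: `f t = ∫_B e^{2iπνt} h ν dν`. -/
structure IsBandSpectrum (B : Set ℝ) (f h : ℝ → ℂ) : Prop where
  memLp : MemLp f 2 volume
  memLp_spectrum : MemLp h 2 volume
  eq_zero : ∀ ν, ν ∉ B → h ν = 0
  eq_integral : ∀ t, f t = ∫ ν in B, Complex.exp (2 * Real.pi * Complex.I * ν * t) * h ν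

/-- The space `F(B)` of square integrable functions whose Fourier transform vanishes outside `B`. -/
def bandLimited (B : Set ℝ) : Set (ℝ → ℂ) :=
  {f | ∃ h, IsBandSpectrum B f h}

/-- The band `[-(1+γ)/(2T), (1+γ)/(2T)]`. -/
def band (T γ : ℝ) : Set ℝ :=
  Set.Icc (-((1 + γ) / (2 * T))) ((1 + γ) / (2 * T))

/-- `κ T ∫|f|⁴ / (∫|f|²)²`. -/
def kurtosisFunctional (κ T : ℝ) (f : ℝ → ℂ) : ℝ :=
  κ * T * ((∫ t, ‖f t‖ ^ 4) / (∫ t, ‖f t‖ ^ 2) ^ 2)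

/-- The functional `Φ`. -/
def Phi (κ T : ℝ) (f : ℝ → ℂ) : ℝ :=
  kurtosisFunctional κ T f + 2
    + 4 * (‖∫ t : ℝ, ((‖f t‖ ^ 2 : ℝ) : ℂ) * Complex.exp (-(2 * Real.pi * Complex.I * (t / T)))‖
        / ∫ t, ‖f t‖ ^ 2) ^ 2
    + ‖∫ t, f t ^ 2‖ ^ 2 / (∫ t, ‖f t‖ ^ 2) ^ 2
    + ‖∫ t : ℝ, f t ^ 2 * Complex.exp (-(2 * Real.pi * Complex.I * (t / T)))‖ ^ 2
        / (∫ t, ‖f t‖ ^ 2) ^ 2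
    + ‖∫ t : ℝ, f t ^ 2 * Complex.exp (2 * Real.pi * Complex.I * (t / T))‖ ^ 2
        / (∫ t, ‖f t‖ ^ 2) ^ 2

/-! ### Time averages, cyclo-correlations, cumulants -/

/-- `(1/(2N+1)) ∑_{n=-N}^{N} u n` tends to `m`. -/
def HasTimeAvg (u : ℤ → ℂ) (m : ℂ) : Prop :=
  Tendsto (fun N : ℕ => (1 / (2 * (N : ℂ) + 1)) * ∑ n ∈ Finset.Icc (-(N : ℤ)) N, u n)
    atTop (𝓝 m)

/-- The time average `<u_n>`. -/
def timeAvg (u : ℤ → ℂ) : ℂ :=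
  limUnder atTop
    (fun N : ℕ => (1 / (2 * (N : ℂ) + 1)) * ∑ n ∈ Finset.Icc (-(N : ℤ)) N, u n)

variable {Ω : Type*} [MeasurableSpace Ω]

/-- The sequence `n ↦ E(x(n+m) x(n)^*) e^{-2iπnα}`. -/
def cycSeq (P : Measure Ω) (x : ℤ → Lp ℂ 2 P) (α : ℝ) (m : ℤ) (n : ℤ) : ℂ :=
  (∫ ω, x (n + m) ω * conj (x n ω) ∂P) * Complex.exp (-(2 * Real.pi * Complex.I * n * α))

/-- The sequence `n ↦ E(x(n+m) x(n)) e^{-2iπnα}`. -/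
def ncycSeq (P : Measure Ω) (x : ℤ → Lp ℂ 2 P) (α : ℝ) (m : ℤ) (n : ℤ) : ℂ :=
  (∫ ω, x (n + m) ω * x n ω ∂P) * Complex.exp (-(2 * Real.pi * Complex.I * n * α))

/-- The cyclo-correlation `R_x^{(α)}(m)`. -/
def cycCorr (P : Measure Ω) (x : ℤ → Lp ℂ 2 P) (α : ℝ) (m : ℤ) : ℂ :=
  timeAvg (cycSeq P x α m)

/-- The non conjugate cyclo-correlation `R_{c,x}^{(α)}(m)`. -/
def ncycCorr (P : Measure Ω) (x : ℤ → Lp ℂ 2 P) (α : ℝ) (m : ℤ) : ℂ :=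
  timeAvg (ncycSeq P x α m)

/-- The joint fourth order cumulant, written with the centred variables. -/
def cum4 (P : Measure Ω) (X Y Z W : Ω → ℂ) : ℂ :=
  let X₀ := fun ω => X ω - ∫ ω', X ω' ∂P
  let Y₀ := fun ω => Y ω - ∫ ω', Y ω' ∂P
  let Z₀ := fun ω => Z ω - ∫ ω', Z ω' ∂P
  let W₀ := fun ω => W ω - ∫ ω', W ω' ∂P
  (∫ ω, X₀ ω * Y₀ ω * Z₀ ω * W₀ ω ∂P)
    - (∫ ω, X₀ ω * Y₀ ω ∂P) * (∫ ω, Z₀ ω * W₀ ω ∂P)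
    - (∫ ω, X₀ ω * Z₀ ω ∂P) * (∫ ω, Y₀ ω * W₀ ω ∂P)
    - (∫ ω, X₀ ω * W₀ ω ∂P) * (∫ ω, Y₀ ω * Z₀ ω ∂P)

/-- `c₄(x) = cum{x, x^*, x, x^*}`. -/
def c4 (P : Measure Ω) (x : Ω → ℂ) : ℂ :=
  cum4 P x (fun ω => conj (x ω)) x (fun ω => conj (x ω))

/-- The averaged cumulant `<c₄(x(n))>`; it is a real number because `c₄` is. -/
def avgC4 (P : Measure Ω) (x : ℤ → Lp ℂ 2 P) : ℝ :=
  (timeAvg (fun n => c4 P (x n))).re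

/-- `β(x) = <c₄(x)> + 2 + 2 ∑_{l=±1} |R_x^{(lα)}(0)|² + ∑_{l=-1,0,1} |R_{c,x}^{(lα)}(0)|²`. -/
def beta (P : Measure Ω) (α : ℝ) (x : ℤ → Lp ℂ 2 P) : ℝ :=
  avgC4 P x + 2
    + 2 * ∑ l ∈ ({-1, 1} : Finset ℤ), ‖cycCorr P x (l * α) 0‖ ^ 2
    + ∑ l ∈ ({-1, 0, 1} : Finset ℤ), ‖ncycCorr P x (l * α) 0‖ ^ 2

/-! ### The BPSK signal -/

/-- An i.i.d. sequence of symbols, each equal to `1` or `-1` with probability `1/2`. -/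
structure IsBPSKSymbols (P : Measure Ω) (a : ℤ → Ω → ℝ) : Prop where
  measurable : ∀ n, Measurable (a n)
  indep : iIndepFun a P
  prob_one : ∀ n, P {ω | a n ω = 1} = 1 / 2
  prob_neg_one : ∀ n, P {ω | a n ω = -1} = 1 / 2

theorem IsBPSKSymbols.memLp {P : Measure Ω} [IsProbabilityMeasure P] {a : ℤ → Ω → ℝ}
    (ha : IsBPSKSymbols P a) (n : ℤ) : MemLp (fun ω => (a n ω : ℂ)) 2 P := by
  have hm : Measurable (fun ω => (a n ω : ℂ)) := Complex.measurable_ofReal.comp (ha.measurable n)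
  refine MemLp.of_bound hm.aestronglyMeasurable 1 ?_
  have h1 : MeasurableSet {ω | a n ω = 1} := ha.measurable n (measurableSet_singleton 1)
  have h2 : MeasurableSet {ω | a n ω = -1} := ha.measurable n (measurableSet_singleton (-1))
  have hd : Disjoint {ω | a n ω = 1} {ω | a n ω = -1} := by
    rw [Set.disjoint_left]
    intro ω h h'
    simp only [Set.mem_ofPred_eq] at h h'
    linarith
  have hu : P ({ω | a n ω = 1} ∪ {ω | a n ω = -1}) = 1 := by
    rw [measure_union hd h2, ha.prob_one, ha.prob_neg_one]
    exact ENNReal.add_halves 1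
  have hae := (prob_compl_eq_zero_iff (h1.union h2)).2 hu
  filter_upwards [(measure_eq_zero_iff_ae_notMem).1 hae] with ω hω
  simp only [Set.mem_compl_iff, not_not, Set.mem_union, Set.mem_ofPred_eq] at hω
  rcases hω with h | h <;> simp [h]

/-- The modulated signal `s_a(t) = ∑_n a_n g(t - nT)`, the series being summed in `L²(Ω)`. -/
def modulated {P : Measure Ω} [IsProbabilityMeasure P] {a : ℤ → Ω → ℝ}
    (ha : IsBPSKSymbols P a) (g : ℝ → ℂ) (T t : ℝ) : Lp ℂ 2 P :=
  ∑' n : ℤ, g (t - n * T) • (ha.memLp n).toLp (fun ω => (a n ω : ℂ))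

/-- The sampled signal `s(n) = s_a(n T_e)`. -/
def sampled {P : Measure Ω} [IsProbabilityMeasure P] {a : ℤ → Ω → ℝ}
    (ha : IsBPSKSymbols P a) (g : ℝ → ℂ) (T Te : ℝ) (n : ℤ) : Lp ℂ 2 P :=
  modulated ha g T (n * Te)

/-! ### Filters -/

/-- `S` is a spectral density of the sequence `x`:
`<E(x(n+m) x(n)^*)> = ∫_{-1/2}^{1/2} S(ν) e^{2iπmν} dν` for all `m`. -/
structure IsSpectralDensity (P : Measure Ω) (x : ℤ → Lp ℂ 2 P) (S : ℝ → ℝ) : Prop where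
  measurable : Measurable S
  nonneg : ∀ ν, 0 ≤ S ν
  integrable : IntegrableOn S (Set.Ioc (-1 / 2) (1 / 2)) volume
  hasTimeAvg : ∀ m : ℤ, HasTimeAvg (cycSeq P x 0 m)
    (∫ ν in Set.Ioc (-1 / 2 : ℝ) (1 / 2),
      (S ν : ℂ) * Complex.exp (2 * Real.pi * Complex.I * m * ν))

open Classical in
/-- The spectral density `S_x^{(0)}`. It is unique up to a set of measure zero in `(-1/2, 1/2]`
(its Fourier coefficients are prescribed), so the choice of a version plays no role. -/
def spectralDensity (P : Measure Ω) (x : ℤ → Lp ℂ 2 P) : ℝ → ℝ :=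
  if h : ∃ S, IsSpectralDensity P x S then h.choose else 0

/-- The norm of the filter with transfer function `f`, with respect to the input `x`:
`‖f‖² = ∫_{-1/2}^{1/2} |f(e^{2iπν})|² S_x^{(0)}(ν) dν`, possibly infinite. -/
def filterNorm (P : Measure Ω) (x : ℤ → Lp ℂ 2 P) (f : Circle → ℂ) : ℝ≥0∞ :=
  (∫⁻ ν in Set.Ioc (-1 / 2 : ℝ) (1 / 2),
    ENNReal.ofReal (‖f (Circle.exp (2 * Real.pi * ν))‖ ^ 2 * spectralDensity P x ν)) ^ (1 / 2 : ℝ)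

/-- The transfer function `∑_l c_l z^{-l}` of a filter with finite impulse response `c`. -/
def firTransfer (c : ℤ →₀ ℂ) (z : Circle) : ℂ :=
  c.sum fun l b => b * ((z ^ (-l) : Circle) : ℂ)

/-- The output `n ↦ ∑_l c_l x(n-l)` of a filter with finite impulse response `c`. -/
def firOutput {P : Measure Ω} (c : ℤ →₀ ℂ) (x : ℤ → Lp ℂ 2 P) (n : ℤ) : Lp ℂ 2 P :=
  c.sum fun l b => b • x (n - l)

/-- `r = [f(z)]x`: the mean square limit of the outputs of finite impulse response filters which
converge to `f` for the norm of filters. -/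
def IsFilterOutput (P : Measure Ω) (x : ℤ → Lp ℂ 2 P) (f : Circle → ℂ) (r : ℤ → Lp ℂ 2 P) : Prop :=
  ∃ c : ℕ → ℤ →₀ ℂ,
    Tendsto (fun k => filterNorm P x (fun z => firTransfer (c k) z - f z)) atTop (𝓝 0) ∧
    ∀ n, Tendsto (fun k => firOutput (c k) x n) atTop (𝓝 (r n))

/-- The set of outputs `[f(z)]x` of the filters of norm `1`. -/
def unitNormOutputs (P : Measure Ω) (x : ℤ → Lp ℂ 2 P) : Set (ℤ → Lp ℂ 2 P) :=
  {r | ∃ f : Circle → ℂ, Measurable (fun ν : ℝ => f (Circle.exp (2 * Real.pi * ν))) ∧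
    filterNorm P x f = 1 ∧ IsFilterOutput P x f r}

end BPSK

end

/-! Write `pulse H` for the signal `r(n) = ∑_m a_m f(n Te - m T)`, where `f = synth H` has spectrum
`H`. Two facts give the theorem: the filters of norm one produce exactly the signals `pulse H` with
`f` in the band and `∫|f|² = T`, and the statistics of `pulse H` are integrals of `f` over the line.

Outputs. Filtering by `f(z)` multiplies the pulse spectrum `G(ξ)` by `f(e^{2iπ Te ξ})`, and the
squared filter norm becomes `T⁻¹` times the energy of the product (`Admissible.filterNorm_eq`). As
the band is narrower than the sampling rate, `ξ ↦ e^{2iπ Te ξ}` is injective on it; as `G ≠ 0` a.e.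
there, every square integrable `H` on the band is such a product (`Admissible.exists_filter`). Mean
square limits cause no ambiguity, because `H ↦ pulse H n` is continuous in `L²`
(`norm_pulse_sq_le`).

Statistics. The symbols are orthonormal and their cumulants add, so `E|r(n)|²`, `E r(n)²` and
`c₄(r(n))` are the sums over `m` of `|f|²`, `f²` and `-2|f|⁴` at `n Te - m T` (`c4_linComb`). Each
is a `T`-periodic function sampled at `n Te`. A compactly supported spectrum makes it a
trigonometric polynomial (`hasSum_synth_mul_conj`). The time average against `e^{-2iπ n l Te/T}`
retains the `l`-th harmonic alone as long as no other harmonic is aliased onto it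
(`hasTimeAvg_corr`), and that harmonic is `T⁻¹` times an integral over the line
(`integral_synth_mul_conj`). The quartic term has harmonics of order up to `3`, whence the excluded
values of `Te`.

Infima. Both functionals are invariant under dilation, so prescribing the energy `T` costs nothing
(`image_bandLimited_eq`). They are bounded below because a band-limited function is bounded by a
multiple of its `L²` norm (`integral_pow_four_le`). -/

noncomputable section

namespace BPSK

/-! ### The character `x ↦ exp (2πix)` -/

/-- `cis x = exp (2πix)`. -/
def cis (x : ℝ) : ℂ := Complex.exp (2 * Real.pi * Complex.I * x)

theorem cis_add (x y : ℝ) : cis (x + y) = cis x * cis y := by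
  simp only [cis, ← Complex.exp_add]; push_cast; ring_nf

theorem cis_zero : cis 0 = 1 := by simp [cis]

theorem cis_intCast (n : ℤ) : cis n = 1 := by
  rw [cis, ← Complex.exp_int_mul_two_pi_mul_I n]; push_cast; ring_nf

theorem norm_cis (x : ℝ) : ‖cis x‖ = 1 := by
  rw [cis, ← Complex.norm_exp_ofReal_mul_I (2 * Real.pi * x)]; push_cast; ring_nf

theorem conj_cis (x : ℝ) : conj (cis x) = cis (-x) := by
  simp only [cis, ← Complex.exp_conj, map_mul, Complex.conj_I, Complex.conj_ofReal, map_ofNat]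
  push_cast; ring_nf

@[fun_prop]
theorem continuous_cis : Continuous cis := by unfold cis; fun_prop

@[fun_prop]
theorem measurable_cis : Measurable cis := continuous_cis.measurable

theorem cis_neg_mul_cis (x : ℝ) : cis (-x) * cis x = 1 := by
  rw [← cis_add, neg_add_cancel, cis_zero]

theorem cis_eq_one_iff (x : ℝ) : cis x = 1 ↔ ∃ n : ℤ, x = n := by
  rw [cis, Complex.exp_eq_one_iff]
  have h : (2 * Real.pi * Complex.I : ℂ) ≠ 0 := Complex.two_pi_I_ne_zero
  refine exists_congr fun n => ?_
  rw [mul_comm, mul_left_inj' h]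
  exact_mod_cast Iff.rfl

/-! ### Unfolding an integral over the translates of a period -/

theorem pairwise_disjoint_Ioc_mul (L : ℝ) :
    Pairwise (Function.onFun Disjoint fun j : ℤ => Set.Ioc (j * L) ((j + 1) * L)) := by
  simpa using Set.pairwise_disjoint_Ioc_zsmul L

theorem iUnion_Ioc_mul {L : ℝ} (hL : 0 < L) :
    ⋃ j : ℤ, Set.Ioc (j * L) ((j + 1) * L) = Set.univ := by
  simpa using iUnion_Ioc_zsmul hL

theorem preimage_add_Ioc (L : ℝ) (j : ℤ) :
    (fun x : ℝ => x + j * L) ⁻¹' Set.Ioc (j * L) ((j + 1) * L) = Set.Ioc 0 L := by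
  ext x; simp [add_mul, add_comm]

theorem measurePreserving_translate (L : ℝ) (j : ℤ) :
    MeasurePreserving (fun x : ℝ => x + j * L) (volume.restrict (Set.Ioc 0 L))
      (volume.restrict (Set.Ioc (j * L) ((j + 1) * L))) := by
  rw [← preimage_add_Ioc L j]
  exact (measurePreserving_add_right (volume : Measure ℝ) (j * L : ℝ)).restrict_preimage
    measurableSet_Ioc

theorem hasSum_setIntegral_translate {E : Type*} [NormedAddCommGroup E] [NormedSpace ℝ E]
    {L : ℝ} (hL : 0 < L) {p : ℝ → E} (hp : Integrable p) :
    HasSum (fun j : ℤ => ∫ x in Set.Ioc 0 L, p (x + j * L)) (∫ x, p x) := by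
  have h := hasSum_integral_iUnion (f := p) (μ := volume) (fun _ : ℤ => measurableSet_Ioc)
    (pairwise_disjoint_Ioc_mul L) hp.integrableOn
  rw [iUnion_Ioc_mul hL, Measure.restrict_univ] at h
  convert! h using 2 with j
  exact (measurePreserving_translate L j).integral_comp
    (MeasurableEquiv.addRight (j * L : ℝ)).measurableEmbedding p

theorem lintegral_eq_tsum_translate {L : ℝ} (hL : 0 < L) (p : ℝ → ℝ≥0∞) :
    ∫⁻ x, p x = ∑' j : ℤ, ∫⁻ x in Set.Ioc 0 L, p (x + j * L) := by
  have h := lintegral_iUnion (μ := volume) (fun _ : ℤ => measurableSet_Ioc)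
    (pairwise_disjoint_Ioc_mul L) p
  rw [iUnion_Ioc_mul hL, Measure.restrict_univ] at h
  rw [h]
  congr 1 with j
  exact ((measurePreserving_translate L j).lintegral_comp_emb
    (MeasurableEquiv.addRight (j * L : ℝ)).measurableEmbedding p).symm

/-! ### Parseval's identity on an interval -/

/-- Parseval on a circle of length `T⁻¹`, with integrals against Lebesgue measure instead of
normalised Haar measure. -/
theorem hasSum_coeff_mul_conj {T : ℝ} (hT : 0 < T) {F K : ℝ → ℂ}
    (hF : MemLp F 2 (volume.restrict (Set.Ioc 0 T⁻¹)))
    (hK : MemLp K 2 (volume.restrict (Set.Ioc 0 T⁻¹))) :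
    HasSum (fun m : ℤ => (∫ ν in Set.Ioc 0 T⁻¹, cis (-(m * T * ν)) * F ν) *
        conj (∫ ν in Set.Ioc 0 T⁻¹, cis (-(m * T * ν)) * K ν))
      ((T⁻¹ : ℝ) * ∫ ν in Set.Ioc 0 T⁻¹, F ν * conj (K ν)) := by
  have hL : 0 < T⁻¹ := inv_pos.2 hT
  have := Fact.mk hL
  have key : ∀ {f : ℝ → ℂ}, MemLp f 2 (volume.restrict (Set.Ioc 0 T⁻¹)) →
      MemLp (AddCircle.liftIoc T⁻¹ 0 f) 2 (AddCircle.haarAddCircle (T := T⁻¹)) := by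
    intro f hf
    rw [← zero_add T⁻¹] at hf
    simpa using (hf.memLp_liftIoc (T := T⁻¹)).haarAddCircle
  have coeff : ∀ {f : ℝ → ℂ} (hf : MemLp f 2 (volume.restrict (Set.Ioc 0 T⁻¹))) (m : ℤ),
      fourierBasis.repr ((key hf).toLp) m =
        T * ∫ ν in Set.Ioc 0 T⁻¹, cis (-(m * T * ν)) * f ν := by
    intro f hf m
    rw [fourierBasis_repr, fourierCoeff_congr_ae (key hf).coeFn_toLp, fourierCoeff_liftIoc_eq,
      fourierCoeffOn_eq_integral]
    simp only [zero_add, sub_zero]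
    rw [intervalIntegral.integral_of_le hL.le]
    simp only [one_div, inv_inv, Complex.real_smul]
    congr 1
    refine integral_congr_ae (Eventually.of_forall fun ν => ?_)
    simp only [fourier_coe_apply, smul_eq_mul, cis]
    congr 2
    push_cast
    simp
    ring
  have h := fourierBasis.hasSum_inner_mul_inner ((key hK).toLp) ((key hF).toLp)
  have h2 : inner ℂ ((key hK).toLp) ((key hF).toLp) =
      T * ∫ ν in Set.Ioc 0 T⁻¹, F ν * conj (K ν) := by
    rw [L2.inner_def]
    have : ∀ᵐ x ∂(AddCircle.haarAddCircle (T := T⁻¹)),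
        inner ℂ ((key hK).toLp _ x) ((key hF).toLp _ x) =
          AddCircle.liftIoc T⁻¹ 0 (fun ν => F ν * conj (K ν)) x := by
      filter_upwards [(key hK).coeFn_toLp, (key hF).coeFn_toLp] with x h1 h2
      rw [h1, h2, RCLike.inner_apply]
      rfl
    rw [integral_congr_ae this, AddCircle.integral_haarAddCircle,
      AddCircle.integral_liftIoc_eq_intervalIntegral, zero_add,
      intervalIntegral.integral_of_le hL.le, inv_inv, Complex.real_smul]
  rw [h2] at h
  -- Normalisation puts a factor `T` in each of the two coefficients and a single factor `T` in the
  -- inner product; dividing by `T²` leaves `T⁻¹` in front of the integral.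
  have h3 := h.mul_left ((T⁻¹ : ℂ) * T⁻¹)
  have hT' : (T : ℂ) ≠ 0 := by exact_mod_cast hT.ne'
  convert! h3 using 1
  · funext m
    rw [← fourierBasis.repr_apply_apply, ← inner_conj_symm, ← fourierBasis.repr_apply_apply,
      coeff hF, coeff hK]
    simp only [map_mul, Complex.conj_ofReal]
    generalize (∫ ν in Set.Ioc 0 T⁻¹, cis (-(m * T * ν)) * F ν) = x
    generalize (∫ ν in Set.Ioc 0 T⁻¹, cis (-(m * T * ν)) * K ν) = y
    push_cast
    field_simp
  · push_cast
    rw [mul_assoc (T : ℂ)⁻¹, inv_mul_cancel_left₀ hT']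

/-! ### Synthesis of a function from a compactly supported spectrum -/

/-- `H` is square integrable and vanishes outside `(-R, R)`. -/
structure SpectrumIn (R : ℝ) (H : ℝ → ℂ) : Prop where
  memLp : MemLp H 2 volume
  eq_zero : ∀ ν, ν ∉ Set.Ioo (-R) R → H ν = 0

/-- The function `t ↦ ∫ e^{2iπνt} H ν dν` with spectrum `H`. -/
def synth (H : ℝ → ℂ) (t : ℝ) : ℂ := ∫ ν, cis (ν * t) * H ν

theorem SpectrumIn.integrable {R : ℝ} {H : ℝ → ℂ} (hH : SpectrumIn R H) : Integrable H := by
  have h1 : IntegrableOn H (Set.Ioo (-R) R) :=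
    (hH.memLp.restrict (Set.Ioo (-R) R)).integrable one_le_two
  exact (integrableOn_iff_integrable_of_support_subset fun ν hν =>
    by_contra fun h => hν (hH.eq_zero ν h)).1 h1

theorem integrable_cis_mul {μ : Measure ℝ} {H : ℝ → ℂ} (hH : Integrable H μ) {φ : ℝ → ℝ}
    (hφ : Measurable φ) : Integrable (fun ν => cis (φ ν) * H ν) μ := by
  refine hH.bdd_mul (c := 1) (measurable_cis.comp hφ).aestronglyMeasurable ?_
  exact Eventually.of_forall fun ν => (norm_cis _).le

theorem memLp_cis_mul {μ : Measure ℝ} {H : ℝ → ℂ} (hH : MemLp H 2 μ) {φ : ℝ → ℝ}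
    (hφ : Measurable φ) : MemLp (fun ν => cis (φ ν) * H ν) 2 μ := by
  refine hH.of_le ((measurable_cis.comp hφ).aestronglyMeasurable.mul hH.1) ?_
  exact Eventually.of_forall fun ν => by rw [norm_mul, norm_cis, one_mul]

theorem continuous_synth {H : ℝ → ℂ} (hH : Integrable H) : Continuous (synth H) := by
  refine continuous_of_dominated (bound := fun ν => ‖H ν‖) (fun t => ?_) (fun t => ?_) hH.norm ?_
  · exact (integrable_cis_mul hH (by fun_prop)).1
  · exact Eventually.of_forall fun ν => by rw [norm_mul, norm_cis, one_mul]
  · exact Eventually.of_forall fun ν => by fun_prop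

/-- The open interval matters at the left end: `-N L` lies in the cell `j = -N-1`, so excluding it
leaves exactly the `2N` cells `-N ≤ j < N`. -/
theorem hasSum_translate_of_support {N : ℕ} {L : ℝ} (hL : 0 < L) {p : ℝ → ℂ} (hp : Integrable p)
    (h0 : ∀ ν, ν ∉ Set.Ioo (-(N * L)) (N * L) → p ν = 0) :
    ∑ j ∈ Finset.Ico (-(N : ℤ)) N, ∫ ν in Set.Ioc 0 L, p (ν + j * L) = ∫ ν, p ν := by
  refine HasSum.unique (hasSum_sum_of_ne_finset_zero fun j hj => ?_)
    (hasSum_setIntegral_translate hL hp)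
  refine setIntegral_eq_zero_of_forall_eq_zero fun ν hν => h0 _ fun h => hj ?_
  have h1 : -(N : ℝ) < j + 1 := by
    refine lt_of_mul_lt_mul_right ?_ hL.le
    linarith [h.1, hν.2]
  have h2 : (j : ℝ) < N := by
    refine lt_of_mul_lt_mul_right ?_ hL.le
    linarith [h.2, hν.1]
  have h1' : -(N : ℤ) < j + 1 := by exact_mod_cast h1
  have h2' : j < (N : ℤ) := by exact_mod_cast h2
  rw [Finset.mem_Ico]
  omega

/-- The periodization of the spectrum `ν ↦ e^{2iπνt} H ν`, with `2N` terms. -/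
def fold (N : ℕ) (L : ℝ) (H : ℝ → ℂ) (t ν : ℝ) : ℂ :=
  ∑ j ∈ Finset.Ico (-(N : ℤ)) N, cis ((ν + j * L) * t) * H (ν + j * L)

theorem memLp_translate {H : ℝ → ℂ} (hH : MemLp H 2 volume) (c L : ℝ) :
    MemLp (fun ν => H (ν + c)) 2 (volume.restrict (Set.Ioc 0 L)) :=
  (hH.comp_measurePreserving (measurePreserving_add_right volume c)).restrict _

theorem memLp_fold {H : ℝ → ℂ} (hH : MemLp H 2 volume) (N : ℕ) (L t : ℝ) :
    MemLp (fold N L H t) 2 (volume.restrict (Set.Ioc 0 L)) :=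
  memLp_finsetSum _ fun j _ => memLp_cis_mul (memLp_translate hH _ L) (by fun_prop)

/-- Poisson summation: `e^{-2iπ m T ν}` has period `T⁻¹` in `ν`, so the samples `f(t - mT)` are the
Fourier coefficients of the periodized spectrum. -/
theorem synth_sub_eq_coeff {N : ℕ} {T : ℝ} (hT : 0 < T) {H : ℝ → ℂ}
    (hH : SpectrumIn (N * T⁻¹) H) (t : ℝ) (m : ℤ) :
    synth H (t - m * T) = ∫ ν in Set.Ioc 0 T⁻¹, cis (-(m * T * ν)) * fold N T⁻¹ H t ν := by
  have hL : 0 < T⁻¹ := inv_pos.2 hT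
  rw [synth, ← hasSum_translate_of_support hL (integrable_cis_mul hH.integrable (by fun_prop))
    (fun ν hν => by rw [hH.eq_zero ν hν, mul_zero])]
  simp only [fold, Finset.mul_sum]
  rw [integral_finsetSum]
  · refine Finset.sum_congr rfl fun j _ => integral_congr_ae (Eventually.of_forall fun ν => ?_)
    have : (ν + j * T⁻¹) * (t - m * T) =
        -(m * T * ν) + (ν + j * T⁻¹) * t + ((-(j * m) : ℤ) : ℝ) := by
      push_cast
      field_simp
      ring
    simp only [this, cis_add, cis_intCast, mul_one, mul_assoc]
  · intro j _
    refine integrable_cis_mul ?_ (by fun_prop)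
    exact (memLp_cis_mul (memLp_translate hH.memLp _ _) (by fun_prop)).integrable one_le_two

theorem hasSum_synth_fold {N : ℕ} {T : ℝ} (hT : 0 < T) {H K : ℝ → ℂ}
    (hH : SpectrumIn (N * T⁻¹) H) (hK : SpectrumIn (N * T⁻¹) K) (t s : ℝ) :
    HasSum (fun m : ℤ => synth H (t - m * T) * conj (synth K (s - m * T)))
      ((T⁻¹ : ℝ) * ∫ ν in Set.Ioc 0 T⁻¹, fold N T⁻¹ H t ν * conj (fold N T⁻¹ K s ν)) := by
  simp only [synth_sub_eq_coeff hT hH, synth_sub_eq_coeff hT hK]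
  exact hasSum_coeff_mul_conj hT (memLp_fold hH.memLp _ _ _) (memLp_fold hK.memLp _ _ _)

/-- The correlation of the `j`-th and `j'`-th translates of two spectra. -/
def corr (T : ℝ) (H K : ℝ → ℂ) (τ : ℝ) (j j' : ℤ) : ℂ :=
  (T⁻¹ : ℝ) * ∫ ν in Set.Ioc 0 T⁻¹,
    cis ((ν + j * T⁻¹) * τ) * (H (ν + j * T⁻¹) * conj (K (ν + j' * T⁻¹)))

theorem memLp_conj {μ : Measure ℝ} {K : ℝ → ℂ} (hK : MemLp K 2 μ) :
    MemLp (fun ν => conj (K ν)) 2 μ :=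
  hK.star

theorem integrable_mul_conj {μ : Measure ℝ} {H K : ℝ → ℂ} (hH : MemLp H 2 μ) (hK : MemLp K 2 μ) :
    Integrable (fun ν => H ν * conj (K ν)) μ :=
  hH.integrable_mul (memLp_conj hK)

/-- As a function of `s` the sum has period `T`. Parseval and expansion of the two periodizations
show it to be a trigonometric polynomial, with harmonics `j - j'` of order at most `2N - 1`. -/
theorem hasSum_synth_mul_conj {N : ℕ} {T : ℝ} (hT : 0 < T) {H K : ℝ → ℂ}
    (hH : SpectrumIn (N * T⁻¹) H) (hK : SpectrumIn (N * T⁻¹) K) (s τ : ℝ) :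
    HasSum (fun m : ℤ => synth H (s + τ - m * T) * conj (synth K (s - m * T)))
      (∑ j ∈ Finset.Ico (-(N : ℤ)) N, ∑ j' ∈ Finset.Ico (-(N : ℤ)) N,
        corr T H K τ j j' * cis ((j - j') * T⁻¹ * s)) := by
  convert! hasSum_synth_fold hT hH hK (s + τ) s using 1
  simp only [fold, map_sum, Finset.sum_mul, Finset.mul_sum, map_mul, conj_cis]
  have hi : ∀ j j' : ℤ, Integrable (fun ν => cis ((ν + j * T⁻¹) * (s + τ)) * H (ν + j * T⁻¹) *
      (cis (-((ν + j' * T⁻¹) * s)) * conj (K (ν + j' * T⁻¹)))) (volume.restrict (Set.Ioc 0 T⁻¹)) :=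
    fun j j' => (memLp_cis_mul (memLp_translate hH.memLp _ _) (by fun_prop)).integrable_mul
      (memLp_cis_mul (memLp_conj (memLp_translate hK.memLp _ _)) (by fun_prop))
  rw [integral_finsetSum _ fun j' _ => integrable_finsetSum _ fun j _ => hi j j', Finset.mul_sum,
    Finset.sum_comm]
  refine Finset.sum_congr rfl fun j' _ => ?_
  rw [integral_finsetSum _ fun j _ => hi j j', Finset.mul_sum]
  refine Finset.sum_congr rfl fun j _ => ?_
  rw [corr, mul_assoc, ← integral_mul_const]
  congr 1
  refine integral_congr_ae (Eventually.of_forall fun ν => ?_)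
  have : (ν + j * T⁻¹) * (s + τ) =
      (ν + j * T⁻¹) * τ + (j - j') * T⁻¹ * s + (ν + j' * T⁻¹) * s := by ring
  simp only [this, cis_add]
  linear_combination (-cis ((ν + j * T⁻¹) * τ) * cis ((j - j') * T⁻¹ * s) *
    H (ν + j * T⁻¹) * conj (K (ν + j' * T⁻¹))) * cis_neg_mul_cis ((ν + j' * T⁻¹) * s)

/-- The diagonal terms are the pieces of one integral cut into cells of length `T⁻¹`; they form the
zeroth harmonic. -/
theorem sum_corr_diag {N : ℕ} {T : ℝ} (hT : 0 < T) {H K : ℝ → ℂ}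
    (hH : SpectrumIn (N * T⁻¹) H) (hK : MemLp K 2 volume) (τ : ℝ) :
    ∑ j ∈ Finset.Ico (-(N : ℤ)) N, corr T H K τ j j =
      (T⁻¹ : ℝ) * ∫ ν, cis (ν * τ) * (H ν * conj (K ν)) := by
  rw [← hasSum_translate_of_support (inv_pos.2 hT)
    (integrable_cis_mul (integrable_mul_conj hH.memLp hK) (by fun_prop))
    (fun ν hν => by rw [hH.eq_zero ν hν, zero_mul, mul_zero]), Finset.mul_sum]
  rfl

theorem summable_sq_synth {N : ℕ} {T : ℝ} (hT : 0 < T) {H : ℝ → ℂ}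
    (hH : SpectrumIn (N * T⁻¹) H) (t : ℝ) :
    HasSum (fun m : ℤ => ‖synth H (t - m * T)‖ ^ 2)
      (T⁻¹ * ∫ ν in Set.Ioc 0 T⁻¹, ‖fold N T⁻¹ H t ν‖ ^ 2) := by
  have h := hasSum_synth_fold hT hH hH t t
  simp only [Complex.mul_conj'] at h
  have e : (∫ ν in Set.Ioc 0 T⁻¹, (‖fold N T⁻¹ H t ν‖ : ℂ) ^ 2) =
      ((∫ ν in Set.Ioc 0 T⁻¹, ‖fold N T⁻¹ H t ν‖ ^ 2 : ℝ) : ℂ) := by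
    rw [← integral_complex_ofReal]; simp
  rw [e] at h
  exact_mod_cast h

/-- Cauchy–Schwarz on the `2N` terms of the periodization. Uniformity in `t` is the point: it yields
square integrability of `synth H`, a sup bound for it, and continuity of the signal in its spectrum.
-/
theorem tsum_sq_synth_le {N : ℕ} {T : ℝ} (hT : 0 < T) {H : ℝ → ℂ}
    (hH : SpectrumIn (N * T⁻¹) H) (t : ℝ) :
    ∑' m : ℤ, ‖synth H (t - m * T)‖ ^ 2 ≤ T⁻¹ * (2 * N * ∫ ν, ‖H ν‖ ^ 2) := by
  rw [(summable_sq_synth hT hH t).tsum_eq]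
  have hL : 0 < T⁻¹ := inv_pos.2 hT
  refine mul_le_mul_of_nonneg_left ?_ hL.le
  have hint : ∀ j : ℤ, Integrable (fun ν => ‖H (ν + j * T⁻¹)‖ ^ 2)
      (volume.restrict (Set.Ioc 0 T⁻¹)) := fun j =>
    (memLp_translate hH.memLp _ _).integrable_norm_pow two_ne_zero
  calc ∫ ν in Set.Ioc 0 T⁻¹, ‖fold N T⁻¹ H t ν‖ ^ 2
      ≤ ∫ ν in Set.Ioc 0 T⁻¹, (2 * N) * ∑ j ∈ Finset.Ico (-(N : ℤ)) N, ‖H (ν + j * T⁻¹)‖ ^ 2 := by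
        refine integral_mono ((memLp_fold hH.memLp N _ t).integrable_norm_pow two_ne_zero)
          ((integrable_finsetSum _ fun j _ => hint j).const_mul _) fun ν => ?_
        have hc : ((Finset.Ico (-(N : ℤ)) N).card : ℝ) = 2 * N := by
          rw [Int.card_Ico, sub_neg_eq_add, ← Nat.cast_add, Int.toNat_natCast]
          push_cast
          ring
        calc ‖fold N T⁻¹ H t ν‖ ^ 2
            ≤ (∑ j ∈ Finset.Ico (-(N : ℤ)) N, ‖H (ν + j * T⁻¹)‖) ^ 2 := by
              refine pow_le_pow_left₀ (norm_nonneg _) ((norm_sum_le _ _).trans_eq ?_) 2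
              simp only [norm_mul, norm_cis, one_mul]
          _ ≤ _ := by
              rw [← hc]
              exact sq_sum_le_card_mul_sum_sq
    _ = 2 * N * ∫ ν, ‖H ν‖ ^ 2 := by
        rw [integral_const_mul, integral_finsetSum _ fun j _ => hint j]
        congr 1
        have h := hasSum_translate_of_support (N := N) hL (p := fun ν => ((‖H ν‖ ^ 2 : ℝ) : ℂ))
          (hH.memLp.integrable_norm_pow two_ne_zero).ofReal
          (fun ν hν => by simp [hH.eq_zero ν hν])
        simp only [integral_complex_ofReal] at h
        exact_mod_cast h

theorem tsum_translate_neg {E : Type*} [AddCommMonoid E] [TopologicalSpace E] (f : ℝ → E)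
    (T t : ℝ) : ∑' j : ℤ, f (t + j * T) = ∑' m : ℤ, f (t - m * T) := by
  rw [← (Equiv.neg ℤ).tsum_eq]
  simp [sub_eq_add_neg]

/-- The energy is the integral over one period of `∑_m |f(t - mT)|²`, which is bounded in `t`. -/
theorem SpectrumIn.memLp_synth {N : ℕ} {T : ℝ} (hT : 0 < T) {H : ℝ → ℂ}
    (hH : SpectrumIn (N * T⁻¹) H) : MemLp (synth H) 2 volume := by
  have hc := continuous_synth hH.integrable
  refine (memLp_two_iff_integrable_sq_norm hc.aestronglyMeasurable).2
    ⟨(hc.norm.pow 2).aestronglyMeasurable, ?_⟩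
  rw [HasFiniteIntegral, lintegral_eq_tsum_translate hT, ← lintegral_tsum]
  · refine (lintegral_mono (g := fun _ =>
      ENNReal.ofReal (T⁻¹ * (2 * N * ∫ ν, ‖H ν‖ ^ 2))) fun t => ?_).trans_lt ?_
    · simp only
      rw [tsum_translate_neg (fun t => ‖‖synth H t‖ ^ 2‖ₑ)]
      simp only [Real.enorm_eq_ofReal (sq_nonneg _)]
      rw [← ENNReal.ofReal_tsum_of_nonneg (fun _ => sq_nonneg _)
        (summable_sq_synth hT hH t).summable]
      exact ENNReal.ofReal_le_ofReal (tsum_sq_synth_le hT hH t)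
    · rw [lintegral_const]
      exact ENNReal.mul_lt_top ENNReal.ofReal_lt_top (by simp)
  · intro j
    have : Continuous fun t => ‖synth H (t + j * T)‖ ^ 2 := by fun_prop
    exact this.enorm.measurable.aemeasurable

theorem integral_cis_period {T : ℝ} (hT : 0 < T) (q : ℤ) :
    ∫ t in Set.Ioc 0 T, cis (q * T⁻¹ * t) = if q = 0 then (T : ℂ) else 0 := by
  split_ifs with hq
  · simp [hq, cis_zero, hT.le]
  · rw [← intervalIntegral.integral_of_le hT.le]
    have hc : (2 * Real.pi * Complex.I * (q * (T : ℂ)⁻¹)) ≠ 0 := by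
      refine mul_ne_zero Complex.two_pi_I_ne_zero (mul_ne_zero (by exact_mod_cast hq) ?_)
      exact inv_ne_zero (by exact_mod_cast hT.ne')
    have h := integral_exp_mul_complex (a := 0) (b := T) hc
    have e : ∀ t : ℝ, cis (q * T⁻¹ * t) =
        Complex.exp (2 * Real.pi * Complex.I * (q * (T : ℂ)⁻¹) * t) := fun t => by
      rw [cis]; push_cast; ring_nf
    simp only [e, h]
    have h1 := cis_intCast q
    have : (2 * Real.pi * Complex.I * (q * (T : ℂ)⁻¹) * T) = 2 * Real.pi * Complex.I * (q : ℝ) := by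
      have : (T : ℂ) ≠ 0 := by exact_mod_cast hT.ne'
      push_cast
      field_simp
    rw [this, ← cis, h1]
    simp

/-- Fold the line onto one period: the periodized integrand is the trigonometric polynomial of
`hasSum_synth_mul_conj`, and integration selects its `l`-th harmonic. The right-hand side is also
the limit in `hasTimeAvg_corr`, which is how time averages become integrals. -/
theorem integral_synth_mul_conj {N : ℕ} {T : ℝ} (hT : 0 < T) {H K : ℝ → ℂ}
    (hH : SpectrumIn (N * T⁻¹) H) (hK : SpectrumIn (N * T⁻¹) K) (l : ℤ) :
    (T⁻¹ : ℝ) * ∫ t, synth H t * conj (synth K t) * cis (-(l * T⁻¹ * t)) =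
      ∑ j ∈ Finset.Ico (-(N : ℤ)) N, ∑ j' ∈ Finset.Ico (-(N : ℤ)) N,
        if j - j' = l then corr T H K 0 j j' else 0 := by
  set p : ℝ → ℂ := fun t => synth H t * conj (synth K t) * cis (-(l * T⁻¹ * t)) with hp
  have hpi : Integrable p := by
    have := integrable_cis_mul (φ := fun t => -(l * T⁻¹ * t))
      (integrable_mul_conj (hH.memLp_synth hT) (hK.memLp_synth hT)) (by fun_prop)
    exact this.congr (Eventually.of_forall fun t => mul_comm _ _)
  have h1 := hasSum_setIntegral_translate hT hpi
  have h2 := hasSum_setIntegral_translate hT hpi.norm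
  -- Interchange of sum and integral, justified by the integrability of `p` on the line.
  have h3 := hasSum_integral_of_summable_integral_norm (μ := volume.restrict (Set.Ioc 0 T))
    (F := fun (j : ℤ) t => p (t + j * T))
    (fun j => (hpi.comp_add_right (j * T : ℝ)).restrict) h2.summable
  have h4 : ∀ t, ∑' j : ℤ, p (t + j * T) = ∑ j ∈ Finset.Ico (-(N : ℤ)) N,
      ∑ j' ∈ Finset.Ico (-(N : ℤ)) N,
        corr T H K 0 j j' * cis (((j - j' - l : ℤ) : ℝ) * T⁻¹ * t) := by
    intro t
    rw [tsum_translate_neg p]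
    have h5 := (hasSum_synth_mul_conj hT hH hK t 0).mul_right (cis (-(l * T⁻¹ * t)))
    simp only [add_zero] at h5
    have h6 : ∀ m : ℤ, p (t - m * T) = synth H (t - m * T) * conj (synth K (t - m * T)) *
        cis (-(l * T⁻¹ * t)) := by
      intro m
      have : -(l * T⁻¹ * (t - m * T)) = -(l * T⁻¹ * t) + ((l * m : ℤ) : ℝ) := by
        push_cast
        field_simp
        ring
      simp only [hp, this, cis_add, cis_intCast, mul_one]
    simp only [h6, h5.tsum_eq, Finset.sum_mul]
    refine Finset.sum_congr rfl fun j _ => Finset.sum_congr rfl fun j' _ => ?_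
    rw [mul_assoc, ← cis_add]
    congr 2
    push_cast
    ring
  rw [h1.unique h3]
  simp only [h4]
  have hi : ∀ j j' : ℤ, Integrable (fun t : ℝ =>
      corr T H K 0 j j' * cis (((j - j' - l : ℤ) : ℝ) * T⁻¹ * t))
        (volume.restrict (Set.Ioc 0 T)) := fun j j' => by
    refine Integrable.const_mul ?_ _
    refine IntegrableOn.mono_set ?_ (Set.Ioc_subset_Icc_self)
    exact Continuous.integrableOn_Icc (by fun_prop)
  rw [integral_finsetSum _ fun j _ => integrable_finsetSum _ fun j' _ => hi j j', Finset.mul_sum]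
  refine Finset.sum_congr rfl fun j _ => ?_
  rw [integral_finsetSum _ fun j' _ => hi j j', Finset.mul_sum]
  refine Finset.sum_congr rfl fun j' _ => ?_
  rw [integral_const_mul, integral_cis_period hT]
  have hT' : (T : ℂ) ≠ 0 := by exact_mod_cast hT.ne'
  by_cases h : j - j' = l
  · rw [if_pos (by omega), if_pos h]
    push_cast
    field_simp
  · rw [if_neg (by omega), if_neg h]
    simp

theorem plancherel_synth {N : ℕ} {T : ℝ} (hT : 0 < T) {H : ℝ → ℂ}
    (hH : SpectrumIn (N * T⁻¹) H) : ∫ t, ‖synth H t‖ ^ 2 = ∫ ν, ‖H ν‖ ^ 2 := by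
  have h1 := integral_synth_mul_conj hT hH hH 0
  have h2 := sum_corr_diag hT hH hH.memLp 0
  have h3 : (T⁻¹ : ℝ) * ∫ t, synth H t * conj (synth H t) * cis (-((0 : ℤ) * T⁻¹ * t)) =
      (T⁻¹ : ℝ) * ∫ ν, cis (ν * 0) * (H ν * conj (H ν)) := by
    rw [h1, ← h2]
    refine Finset.sum_congr rfl fun j hj => ?_
    simp only [sub_eq_zero]
    rw [Finset.sum_ite_eq, if_pos hj]
  have hT' : ((T⁻¹ : ℝ) : ℂ) ≠ 0 := by exact_mod_cast (inv_pos.2 hT).ne'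
  have h4 := mul_left_cancel₀ hT' h3
  simp only [Complex.mul_conj', Int.cast_zero, zero_mul, neg_zero, mul_zero, cis_zero, mul_one,
    one_mul] at h4
  have e : ∀ f : ℝ → ℂ, (∫ t, (‖f t‖ : ℂ) ^ 2) = ((∫ t, ‖f t‖ ^ 2 : ℝ) : ℂ) := fun f => by
    rw [← integral_complex_ofReal]; simp
  rw [e, e] at h4
  exact_mod_cast h4

/-! ### Spectra of conjugates and of products -/

theorem SpectrumIn.conj_neg {R : ℝ} {H : ℝ → ℂ} (hH : SpectrumIn R H) :
    SpectrumIn R (fun ν => conj (H (-ν))) where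
  memLp := memLp_conj (hH.memLp.comp_measurePreserving (Measure.measurePreserving_neg volume))
  eq_zero ν hν := by
    rw [hH.eq_zero (-ν), map_zero]
    exact fun h => hν ⟨by linarith [h.2], by linarith [h.1]⟩

theorem synth_conj_neg (H : ℝ → ℂ) (t : ℝ) :
    synth (fun ν => conj (H (-ν))) t = conj (synth H t) := by
  rw [synth, synth, ← integral_conj, ← integral_neg_eq_self]
  simp only [neg_neg, map_mul, conj_cis, neg_mul]

-- The spectrum of a product is the convolution of the spectra, supported in the doubled band.
open scoped Convolution FourierTransform in
theorem SpectrumIn.exists_mul {R : ℝ} {H K : ℝ → ℂ} (hH : SpectrumIn R H)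
    (hK : SpectrumIn R K) :
    ∃ U, SpectrumIn (2 * R) U ∧ ∀ t, synth U t = synth H t * synth K t := by
  set U := H ⋆[ContinuousLinearMap.mul ℂ ℂ, volume] K with hU
  have hUi : Integrable U := hH.integrable.integrable_convolution _ hK.integrable
  have hF : ∀ (F : ℝ → ℂ) (t : ℝ), synth F t = 𝓕 F (-t) := fun F t => by
    rw [Real.fourier_eq', synth]
    refine integral_congr_ae (Eventually.of_forall fun ν => ?_)
    simp only [smul_eq_mul, cis, RCLike.inner_apply, conj_trivial]
    congr 2
    push_cast
    ring
  refine ⟨U, ⟨?_, fun ν hν => ?_⟩, fun t => ?_⟩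
  · rw [memLp_two_iff_integrable_sq_norm hUi.1]
    -- From `|xy| ≤ |x|² + |y|²` and translation invariance. A bounded integrable function is square
    -- integrable.
    have hb : ∀ x, ‖U x‖ ≤ (∫ ν, ‖H ν‖ ^ 2) + ∫ ν, ‖K ν‖ ^ 2 := by
      intro x
      have i1 := hH.memLp.integrable_norm_pow two_ne_zero
      have i2 := hK.memLp.integrable_norm_pow two_ne_zero
      rw [← integral_sub_left_eq_self (fun ν => ‖K ν‖ ^ 2) volume x,
        ← integral_add i1 (i2.comp_sub_left x)]
      refine norm_integral_le_of_norm_le (i1.add (i2.comp_sub_left x))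
        (Eventually.of_forall fun ν => ?_)
      rw [ContinuousLinearMap.mul_apply', norm_mul]
      nlinarith [sq_nonneg (‖H ν‖ - ‖K (x - ν)‖), sq_nonneg (‖H ν‖), sq_nonneg (‖K (x - ν)‖)]
    simp only [sq]
    refine hUi.norm.bdd_mul (c := (∫ ν, ‖H ν‖ ^ 2) + ∫ ν, ‖K ν‖ ^ 2) hUi.1.norm (Eventually.of_forall fun x => ?_)
    rw [norm_norm]
    exact hb x
  · rw [hU, convolution_def]
    refine integral_eq_zero_of_ae (Eventually.of_forall fun x => ?_)
    simp only [ContinuousLinearMap.mul_apply', Pi.zero_apply]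
    by_cases hx : x ∈ Set.Ioo (-R) R
    · rw [hK.eq_zero (ν - x), mul_zero]
      exact fun h => hν ⟨by linarith [h.1, hx.1], by linarith [h.2, hx.2]⟩
    · rw [hH.eq_zero x hx, zero_mul]
  · rw [hF, hF, hF, hU, Real.fourier_mul_convolution_eq hH.integrable hK.integrable]

/-! ### Time averages -/

theorem sum_Icc_cis (θ : ℝ) (N : ℕ) :
    (cis θ - 1) * ∑ n ∈ Finset.Icc (-(N : ℤ)) N, cis (θ * n) =
      cis (θ * (N + 1)) - cis (-(θ * N)) := by
  induction N with
  | zero => simp [cis_zero]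
  | succ N ih =>
    have e : Finset.Icc (-((N + 1 : ℕ) : ℤ)) (N + 1 : ℕ) =
        insert (N + 1 : ℤ) (insert (-(N + 1 : ℤ)) (Finset.Icc (-(N : ℤ)) N)) := by
      ext x
      simp only [Finset.mem_Icc, Finset.mem_insert]
      omega
    rw [e, Finset.sum_insert, Finset.sum_insert, mul_add, mul_add, ih]
    · have e1 : cis (θ * ((N + 1 : ℕ) + 1)) = cis θ * cis (θ * (N + 1)) := by
        rw [← cis_add]; push_cast; ring_nf
      have e2 : cis (-(θ * N)) = cis θ * cis (-(θ * (N + 1))) := by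
        rw [← cis_add]; ring_nf
      rw [e1, e2]
      push_cast
      rw [mul_neg]
      ring
    · simp
    · simp only [Finset.mem_insert, Finset.mem_Icc]
      omega

theorem HasTimeAvg.const_mul {u : ℤ → ℂ} {m : ℂ} (h : HasTimeAvg u m) (c : ℂ) :
    HasTimeAvg (fun n => c * u n) (c * m) := by
  refine (Tendsto.const_mul c h).congr fun N => ?_
  rw [← Finset.mul_sum]
  ring

theorem HasTimeAvg.sum {ι : Type*} {s : Finset ι} {u : ι → ℤ → ℂ} {m : ι → ℂ}
    (h : ∀ i ∈ s, HasTimeAvg (u i) (m i)) :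
    HasTimeAvg (fun n => ∑ i ∈ s, u i n) (∑ i ∈ s, m i) := by
  refine (tendsto_finsetSum s h).congr fun N => ?_
  rw [Finset.sum_comm, Finset.mul_sum]

theorem hasTimeAvg_cis_zero : HasTimeAvg (fun n => cis (0 * n)) 1 := by
  refine tendsto_const_nhds.congr fun N => ?_
  simp only [zero_mul, cis_zero, Finset.sum_const, Int.card_Icc, nsmul_eq_mul, mul_one]
  have : ((N : ℤ) + 1 - -(N : ℤ)).toNat = 2 * N + 1 := by omega
  rw [this]
  have : (2 * (N : ℂ) + 1) ≠ 0 := by exact_mod_cast (Nat.succ_ne_zero (2 * N))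
  push_cast
  field_simp

/-- The geometric sums stay below `2 / |cis θ - 1|` while the prefactor tends to zero. -/
theorem hasTimeAvg_cis {θ : ℝ} (hθ : ∀ z : ℤ, θ ≠ z) : HasTimeAvg (fun n => cis (θ * n)) 0 := by
  have h1 : cis θ - 1 ≠ 0 := by
    rw [sub_ne_zero]
    intro h
    obtain ⟨z, hz⟩ := (cis_eq_one_iff θ).1 h
    exact hθ z hz
  have h2 : Tendsto (fun N : ℕ => (1 / (2 * (N : ℂ) + 1))) atTop (𝓝 0) := by
    rw [tendsto_zero_iff_norm_tendsto_zero]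
    have : Tendsto (fun N : ℕ => 1 / (2 * (N : ℝ) + 1)) atTop (𝓝 0) := by
      refine Tendsto.div_atTop tendsto_const_nhds ?_
      exact tendsto_atTop_add_const_right _ _
        (Tendsto.const_mul_atTop two_pos tendsto_natCast_atTop_atTop)
    refine this.congr fun N => ?_
    rw [norm_div, norm_one]
    congr 1
    have : (2 * (N : ℂ) + 1) = ((2 * (N : ℝ) + 1 : ℝ) : ℂ) := by push_cast; rfl
    rw [this, Complex.norm_real, Real.norm_of_nonneg (by positivity)]
  refine h2.zero_mul_isBoundedUnder_le ?_
  refine isBoundedUnder_of ⟨2 / ‖cis θ - 1‖, fun N => ?_⟩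
  simp only [Function.comp_apply]
  rw [le_div_iff₀ (norm_pos_iff.2 h1), mul_comm, ← norm_mul, sum_Icc_cis]
  refine (norm_sub_le _ _).trans ?_
  rw [norm_cis, norm_cis]
  norm_num

theorem HasTimeAvg.timeAvg_eq {u : ℤ → ℂ} {m : ℂ} (h : HasTimeAvg u m) : timeAvg u = m :=
  h.limUnder_eq

/-- The time average of the sampled correlation of two band-limited functions; `hα` says that no
aliasing of the harmonics of `1/T` occurs. -/
theorem hasTimeAvg_corr {N : ℕ} {T Te : ℝ} (H K : ℝ → ℂ) (τ : ℝ) (l : ℤ)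
    (hα : ∀ q : ℤ, q ≠ 0 → |q| ≤ 2 * N - 1 + |l| → ∀ z : ℤ, q * (Te / T) ≠ z) :
    HasTimeAvg (fun n => (∑ j ∈ Finset.Ico (-(N : ℤ)) N, ∑ j' ∈ Finset.Ico (-(N : ℤ)) N,
        corr T H K τ j j' * cis ((j - j') * T⁻¹ * (n * Te))) *
          Complex.exp (-(2 * Real.pi * Complex.I * n * (((l : ℝ) * (Te / T) : ℝ) : ℂ))))
      (∑ j ∈ Finset.Ico (-(N : ℤ)) N, ∑ j' ∈ Finset.Ico (-(N : ℤ)) N,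
        if j - j' = l then corr T H K τ j j' else 0) := by
  have h : HasTimeAvg (fun n => ∑ j ∈ Finset.Ico (-(N : ℤ)) N, ∑ j' ∈ Finset.Ico (-(N : ℤ)) N,
        corr T H K τ j j' * cis ((((j - j' - l : ℤ) : ℝ) * (Te / T)) * n))
      (∑ j ∈ Finset.Ico (-(N : ℤ)) N, ∑ j' ∈ Finset.Ico (-(N : ℤ)) N,
        if j - j' = l then corr T H K τ j j' else 0) := by
    refine HasTimeAvg.sum fun j hj => HasTimeAvg.sum fun j' hj' => ?_
    rw [Finset.mem_Ico] at hj hj'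
    split_ifs with hl
    · have : j - j' - l = 0 := by omega
      simpa [this] using hasTimeAvg_cis_zero.const_mul (corr T H K τ j j')
    · have := (hasTimeAvg_cis (hα (j - j' - l) (by omega) (by
        have h1 : |j - j'| ≤ 2 * N - 1 := abs_le.2 ⟨by omega, by omega⟩
        exact (abs_sub _ _).trans (by omega)))).const_mul (corr T H K τ j j')
      simpa using this
  convert! h using 1
  funext n
  rw [Finset.sum_mul]
  refine Finset.sum_congr rfl fun j _ => ?_
  rw [Finset.sum_mul]
  refine Finset.sum_congr rfl fun j' _ => ?_
  have e : Complex.exp (-(2 * Real.pi * Complex.I * n * (((l : ℝ) * (Te / T) : ℝ) : ℂ))) =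
      cis (-(l * (Te / T) * n)) := by
    rw [cis]; push_cast; ring_nf
  rw [e, mul_assoc, ← cis_add]
  congr 2
  push_cast
  ring

/-! ### Finite combinations of the symbols -/

section Symbols

variable {Ω : Type*} [MeasurableSpace Ω] {P : Measure Ω} {a : ℤ → Ω → ℝ}

/-- The combination `∑_{m ∈ s} v m a_m` of finitely many symbols. -/
def finComb (a : ℤ → Ω → ℝ) (v : ℤ → ℂ) (s : Finset ℤ) (ω : Ω) : ℂ := ∑ m ∈ s, v m * a m ω

theorem IsBPSKSymbols.measurable_finComb (ha : IsBPSKSymbols P a) (v : ℤ → ℂ) (s : Finset ℤ) :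
    Measurable (finComb a v s) :=
  Finset.measurable_sum _ fun m _ =>
    (Complex.measurable_ofReal.comp (ha.measurable m)).const_mul (v m)

variable [IsProbabilityMeasure P]

theorem IsBPSKSymbols.ae_eq (ha : IsBPSKSymbols P a) (n : ℤ) :
    ∀ᵐ ω ∂P, a n ω = 1 ∨ a n ω = -1 := by
  have h1 : MeasurableSet {ω | a n ω = 1} := ha.measurable n (measurableSet_singleton 1)
  have h2 : MeasurableSet {ω | a n ω = -1} := ha.measurable n (measurableSet_singleton (-1))
  have hd : Disjoint {ω | a n ω = 1} {ω | a n ω = -1} := by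
    rw [Set.disjoint_left]
    intro ω h h'
    simp only [Set.mem_ofPred_eq] at h h'
    linarith
  have hu : P ({ω | a n ω = 1} ∪ {ω | a n ω = -1}) = 1 := by
    rw [measure_union hd h2, ha.prob_one, ha.prob_neg_one]
    exact ENNReal.add_halves 1
  have hae := (prob_compl_eq_zero_iff (h1.union h2)).2 hu
  filter_upwards [(measure_eq_zero_iff_ae_notMem).1 hae] with ω hω
  simpa only [Set.mem_compl_iff, not_not, Set.mem_union, Set.mem_ofPred_eq] using hω

theorem IsBPSKSymbols.integral_eq_zero (ha : IsBPSKSymbols P a) (n : ℤ) :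
    ∫ ω, (a n ω : ℂ) ∂P = 0 := by
  have h1 : MeasurableSet {ω | a n ω = 1} := ha.measurable n (measurableSet_singleton 1)
  have h2 : MeasurableSet {ω | a n ω = -1} := ha.measurable n (measurableSet_singleton (-1))
  have h : ∀ᵐ ω ∂P, (a n ω : ℂ) = Set.indicator {ω | a n ω = 1} (fun _ => (1 : ℂ)) ω -
      Set.indicator {ω | a n ω = -1} (fun _ => (1 : ℂ)) ω := by
    filter_upwards [ha.ae_eq n] with ω hω
    rcases hω with hω | hω <;> norm_num [Set.indicator, hω]
  rw [integral_congr_ae h, integral_sub ((integrable_const _).indicator h1)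
    ((integrable_const _).indicator h2), integral_indicator h1, integral_indicator h2]
  simp [Measure.real, ha.prob_one, ha.prob_neg_one]

theorem IsBPSKSymbols.norm_finComb_le (ha : IsBPSKSymbols P a) (v : ℤ → ℂ) (s : Finset ℤ) :
    ∀ᵐ ω ∂P, ‖finComb a v s ω‖ ≤ ∑ m ∈ s, ‖v m‖ := by
  have h : ∀ᵐ ω ∂P, ∀ m, a m ω = 1 ∨ a m ω = -1 := ae_all_iff.2 ha.ae_eq
  filter_upwards [h] with ω hω
  refine norm_sum_le_of_le _ fun m _ => ?_
  rcases hω m with h | h <;> simp [h]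

theorem IsBPSKSymbols.integrable_comp_finComb (ha : IsBPSKSymbols P a) (v : ℤ → ℂ) (s : Finset ℤ)
    {E : Type*} [NormedAddCommGroup E] [SecondCountableTopology E] [MeasurableSpace E]
    [BorelSpace E] {φ : ℂ → E} (hφ : Continuous φ) :
    Integrable (fun ω => φ (finComb a v s ω)) P := by
  obtain ⟨C, hC⟩ := (isCompact_closedBall (0 : ℂ) (∑ m ∈ s, ‖v m‖)).exists_bound_of_continuousOn
    hφ.continuousOn
  refine Integrable.of_bound (hφ.measurable.comp (ha.measurable_finComb v s)).aestronglyMeasurable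
    C ?_
  filter_upwards [ha.norm_finComb_le v s] with ω hω
  exact hC _ (by simpa using hω)

/-- A symbol outside `s` is centred and independent of every function of the symbols in `s`. This
removes the odd terms in the induction for the moments. -/
theorem IsBPSKSymbols.integral_comp_finComb_mul (ha : IsBPSKSymbols P a) (v : ℤ → ℂ)
    {s : Finset ℤ} {m : ℤ} (hm : m ∉ s) {φ : ℂ → ℂ} (hφ : Continuous φ) :
    ∫ ω, φ (finComb a v s ω) * a m ω ∂P = 0 := by
  have hind := ha.indep.indepFun_finset s {m} (by simpa using hm) ha.measurable
  have h1 : Measurable fun x : s → ℝ => φ (∑ i : s, v i * x i) := by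
    refine hφ.measurable.comp (Finset.measurable_sum _ fun i _ => ?_)
    exact (Complex.measurable_ofReal.comp (measurable_pi_apply i)).const_mul _
  have h2 : Measurable fun x : ({m} : Finset ℤ) → ℝ => (x ⟨m, by simp⟩ : ℂ) :=
    Complex.measurable_ofReal.comp (measurable_pi_apply _)
  have h := (hind.comp h1 h2).integral_fun_mul_eq_mul_integral
    (h1.comp (measurable_pi_lambda _ fun i => ha.measurable i)).aestronglyMeasurable
    (h2.comp (measurable_pi_lambda _ fun i => ha.measurable i)).aestronglyMeasurable
  have e : ∀ ω, ∑ i : {x // x ∈ s}, v i.1 * a i.1 ω = finComb a v s ω := fun ω =>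
    Finset.sum_coe_sort s fun i => v i * a i ω
  simp only [Function.comp_def, e] at h
  rw [h, ha.integral_eq_zero, mul_zero]

/-- Induction on `s`: since `a_m² = 1`, each moment of `v_m a_m + Y` expands as an even part plus an
odd part times `a_m`, and the odd part has mean zero. In the fourth moment the first two terms are
the Gaussian ones, and `-2` is the kurtosis of a symbol. -/
theorem IsBPSKSymbols.moments_finComb (ha : IsBPSKSymbols P a) (v : ℤ → ℂ) (s : Finset ℤ) :
    ∫ ω, ‖finComb a v s ω‖ ^ 2 ∂P = ∑ m ∈ s, ‖v m‖ ^ 2 ∧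
    ∫ ω, finComb a v s ω ^ 2 ∂P = ∑ m ∈ s, v m ^ 2 ∧
    ∫ ω, ‖finComb a v s ω‖ ^ 4 ∂P = 2 * (∑ m ∈ s, ‖v m‖ ^ 2) ^ 2 + ‖∑ m ∈ s, v m ^ 2‖ ^ 2 -
      2 * ∑ m ∈ s, ‖v m‖ ^ 4 := by
  classical
  induction s using Finset.induction_on with
  | empty => simp [finComb]
  | insert m s hm ih =>
    obtain ⟨h1, h2, h3⟩ := ih
    have hr : ∀ φ : ℂ → ℝ, Continuous φ → ∫ ω, φ (finComb a v s ω) * a m ω ∂P = 0 := by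
      intro φ hφ
      have := ha.integral_comp_finComb_mul v hm (φ := fun z => (φ z : ℂ)) (by fun_prop)
      have e : ∀ ω, (φ (finComb a v s ω) : ℂ) * a m ω =
          ((φ (finComb a v s ω) * a m ω : ℝ) : ℂ) := fun ω => by push_cast; rfl
      simp only [e, integral_complex_ofReal] at this
      exact_mod_cast this
    have hri : ∀ φ : ℂ → ℝ, Continuous φ →
        Integrable (fun ω => φ (finComb a v s ω) * a m ω) P := by
      intro φ hφ
      refine (ha.integrable_comp_finComb v s hφ).mul_bdd (c := 1)
        (ha.measurable m).aestronglyMeasurable ?_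
      filter_upwards [ha.ae_eq m] with ω hω
      rcases hω with h | h <;> simp [h]
    have hci : ∀ φ : ℂ → ℂ, Continuous φ →
        Integrable (fun ω => φ (finComb a v s ω) * a m ω) P := by
      intro φ hφ
      refine (ha.integrable_comp_finComb v s hφ).mul_bdd (c := 1)
        (Complex.measurable_ofReal.comp (ha.measurable m)).aestronglyMeasurable ?_
      filter_upwards [ha.ae_eq m] with ω hω
      rcases hω with h | h <;> simp [h]
    have hsum : ∀ ω, finComb a v (insert m s) ω = v m * a m ω + finComb a v s ω := fun ω => by
      rw [finComb, Finset.sum_insert hm, finComb]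
    have hns : ∀ ω, a m ω = 1 ∨ a m ω = -1 → ‖finComb a v (insert m s) ω‖ ^ 2 =
        (‖finComb a v s ω‖ ^ 2 + ‖v m‖ ^ 2) +
          (2 * (conj (v m) * finComb a v s ω).re) * a m ω := by
      intro ω hω
      rw [hsum, ← Complex.normSq_eq_norm_sq, ← Complex.normSq_eq_norm_sq,
        ← Complex.normSq_eq_norm_sq]
      rcases hω with h | h <;>
      · rw [h]
        simp only [Complex.normSq_apply, Complex.add_re, Complex.add_im, Complex.mul_re,
          Complex.mul_im, Complex.conj_re, Complex.conj_im, Complex.ofReal_re, Complex.ofReal_im]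
        ring
    have hi2 := ha.integrable_comp_finComb v s (φ := fun z => ‖z‖ ^ 2) (by fun_prop)
    have hi4 := ha.integrable_comp_finComb v s (φ := fun z => ‖z‖ ^ 4) (by fun_prop)
    have hic := ha.integrable_comp_finComb v s (φ := fun z => z ^ 2) (by fun_prop)
    rw [Finset.sum_insert hm, Finset.sum_insert hm, Finset.sum_insert hm]
    refine ⟨?_, ?_, ?_⟩
    · have e : ∀ᵐ ω ∂P, ‖finComb a v (insert m s) ω‖ ^ 2 =
          (‖finComb a v s ω‖ ^ 2 + ‖v m‖ ^ 2) +
            (2 * (conj (v m) * finComb a v s ω).re) * a m ω := by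
        filter_upwards [ha.ae_eq m] with ω hω using hns ω hω
      have hφ : Continuous fun z => 2 * (conj (v m) * z).re := by fun_prop
      rw [integral_congr_ae e, integral_add (hi2.fun_add (integrable_const _)) (hri _ hφ), hr _ hφ,
        integral_add hi2 (integrable_const _), h1]
      simp
      ring
    · have e : ∀ᵐ ω ∂P, finComb a v (insert m s) ω ^ 2 =
          (finComb a v s ω ^ 2 + v m ^ 2) + (2 * v m * finComb a v s ω) * a m ω := by
        filter_upwards [ha.ae_eq m] with ω hω
        rw [hsum]
        rcases hω with h | h <;>
        · rw [h]
          push_cast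
          ring
      have hφ : Continuous fun z : ℂ => 2 * v m * z := by fun_prop
      rw [integral_congr_ae e, integral_add (hic.fun_add (integrable_const _)) (hci _ hφ),
        ha.integral_comp_finComb_mul v hm hφ, integral_add hic (integrable_const _), h2]
      simp
      ring
    · have e : ∀ᵐ ω ∂P, ‖finComb a v (insert m s) ω‖ ^ 4 =
          (‖finComb a v s ω‖ ^ 4 + (4 * ‖v m‖ ^ 2) * ‖finComb a v s ω‖ ^ 2 + ‖v m‖ ^ 4 +
            (2 * (conj (v m) ^ 2 * finComb a v s ω ^ 2)).re) +
            (2 * (‖finComb a v s ω‖ ^ 2 + ‖v m‖ ^ 2) *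
              (2 * (conj (v m) * finComb a v s ω).re)) * a m ω := by
        filter_upwards [ha.ae_eq m] with ω hω
        -- `(2 Re x)² = 2|x|² + 2 Re x²` with `x = conj (v m) * Y`.
        have hY : (2 * (conj (v m) * finComb a v s ω).re) ^ 2 =
            2 * ‖v m‖ ^ 2 * ‖finComb a v s ω‖ ^ 2 +
              (2 * (conj (v m) ^ 2 * finComb a v s ω ^ 2)).re := by
          rw [← Complex.normSq_eq_norm_sq, ← Complex.normSq_eq_norm_sq]
          simp only [Complex.normSq_apply, Complex.mul_re, Complex.mul_im, Complex.conj_re,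
            Complex.conj_im, sq, Complex.re_ofNat, Complex.im_ofNat]
          ring
        have h4 : ‖finComb a v (insert m s) ω‖ ^ 4 = (‖finComb a v (insert m s) ω‖ ^ 2) ^ 2 := by
          ring
        rw [h4, hns ω hω]
        have ha2 : a m ω ^ 2 = 1 := by rcases hω with h | h <;> simp [h]
        linear_combination hY + (2 * (conj (v m) * finComb a v s ω).re) ^ 2 * ha2
      have hφ : Continuous fun z : ℂ => 2 * (‖z‖ ^ 2 + ‖v m‖ ^ 2) * (2 * (conj (v m) * z).re) := by
        fun_prop
      have hic' : Integrable (fun ω => (2 * (conj (v m) ^ 2 * finComb a v s ω ^ 2)).re) P :=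
        ha.integrable_comp_finComb v s (φ := fun z => (2 * (conj (v m) ^ 2 * z ^ 2)).re)
          (by fun_prop)
      have hre : ∫ ω, (2 * (conj (v m) ^ 2 * finComb a v s ω ^ 2)).re ∂P =
          (2 * (conj (v m) ^ 2 * ∑ m ∈ s, v m ^ 2)).re := by
        rw [← h2, ← integral_const_mul, ← integral_const_mul]
        exact integral_re (𝕜 := ℂ) ((hic.const_mul _).const_mul _)
      rw [integral_congr_ae e, integral_add ((((hi4.fun_add (hi2.const_mul _)).fun_add
        (integrable_const _))).fun_add hic') (hri _ hφ), hr _ hφ,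
        integral_add ((hi4.fun_add (hi2.const_mul _)).fun_add (integrable_const _)) hic', hre,
        integral_add (hi4.fun_add (hi2.const_mul _)) (integrable_const _),
        integral_add hi4 (hi2.const_mul _), integral_const_mul, h1, h3]
      generalize (∑ m ∈ s, ‖v m‖ ^ 2) = A
      generalize (∑ m ∈ s, v m ^ 2) = B
      generalize (∑ m ∈ s, ‖v m‖ ^ 4) = C
      have hB : ‖v m ^ 2 + B‖ ^ 2 = ‖B‖ ^ 2 + ‖v m‖ ^ 4 + (2 * (conj (v m) ^ 2 * B)).re := by
        have h4 : ‖v m‖ ^ 4 = (‖v m‖ ^ 2) ^ 2 := by ring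
        rw [h4, ← Complex.normSq_eq_norm_sq, ← Complex.normSq_eq_norm_sq,
          ← Complex.normSq_eq_norm_sq]
        simp only [Complex.normSq_apply, Complex.mul_re, Complex.mul_im, Complex.conj_re,
          Complex.conj_im, sq, Complex.re_ofNat, Complex.im_ofNat, Complex.add_re, Complex.add_im]
        ring
      rw [hB]
      simp
      ring

end Symbols

/-! ### Square summable combinations of the symbols -/

section Linear

variable {Ω : Type*} [MeasurableSpace Ω] {P : Measure Ω} {a : ℤ → Ω → ℝ}

theorem inner_eq_integral (x y : Lp ℂ 2 P) : inner ℂ y x = ∫ ω, x ω * conj (y ω) ∂P := by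
  rw [L2.inner_def]
  rfl

theorem norm_pow_four_Lp (f : Lp ℂ 4 P) : ‖f‖ ^ 4 = ∫ ω, ‖f ω‖ ^ 4 ∂P := by
  rw [Lp.norm_def, (Lp.memLp f).eLpNorm_eq_integral_rpow_norm (by norm_num) (by norm_num)]
  have h0 : 0 ≤ ∫ ω, ‖f ω‖ ^ (4 : ℝ≥0∞).toReal ∂P :=
    integral_nonneg fun ω => by positivity
  rw [ENNReal.toReal_ofReal (by positivity), ← Real.rpow_natCast, ← Real.rpow_mul h0]
  norm_num

variable [IsProbabilityMeasure P]

/-- The symbol `a_m` as an element of `L²(Ω)`. -/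
def sym (ha : IsBPSKSymbols P a) (m : ℤ) : Lp ℂ 2 P := (ha.memLp m).toLp (fun ω => (a m ω : ℂ))

/-- The combination `∑_m v m a_m`, the series being summed in `L²(Ω)`. -/
def linComb (ha : IsBPSKSymbols P a) (v : ℤ → ℂ) : Lp ℂ 2 P := ∑' m, v m • sym ha m

theorem coeFn_sym (ha : IsBPSKSymbols P a) (m : ℤ) : sym ha m =ᵐ[P] fun ω => (a m ω : ℂ) :=
  (ha.memLp m).coeFn_toLp

theorem integral_symbol_mul (ha : IsBPSKSymbols P a) (m n : ℤ) :
    ∫ ω, (a m ω : ℂ) * a n ω ∂P = if m = n then 1 else 0 := by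
  split_ifs with h
  · subst h
    have e : ∀ᵐ ω ∂P, (a m ω : ℂ) * a m ω = 1 := by
      filter_upwards [ha.ae_eq m] with ω hω
      rcases hω with h | h <;> simp [h]
    rw [integral_congr_ae e]
    simp
  · have := ha.integral_comp_finComb_mul (fun _ => 1) (s := {m}) (m := n)
      (by simpa using Ne.symm h) continuous_id
    simpa [finComb] using this

theorem orthonormal_sym (ha : IsBPSKSymbols P a) : Orthonormal ℂ (sym ha) := by
  rw [orthonormal_iff_ite]
  intro m n
  rw [inner_eq_integral, ← integral_symbol_mul ha m n]
  refine integral_congr_ae ?_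
  filter_upwards [coeFn_sym ha m, coeFn_sym ha n] with ω h1 h2
  rw [h1, h2, Complex.conj_ofReal, mul_comm]

theorem summable_smul_sym (ha : IsBPSKSymbols P a) {v : ℤ → ℂ}
    (hv : Summable fun m => ‖v m‖ ^ 2) : Summable fun m => v m • sym ha m := by
  have h := ((orthonormal_sym ha).orthogonalFamily.summable_iff_norm_sq_summable v).2 hv
  simpa using h

theorem hasSum_linComb (ha : IsBPSKSymbols P a) {v : ℤ → ℂ}
    (hv : Summable fun m => ‖v m‖ ^ 2) : HasSum (fun m => v m • sym ha m) (linComb ha v) :=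
  (summable_smul_sym ha hv).hasSum

theorem inner_sym_linComb (ha : IsBPSKSymbols P a) {v : ℤ → ℂ}
    (hv : Summable fun m => ‖v m‖ ^ 2) (m : ℤ) : inner ℂ (sym ha m) (linComb ha v) = v m := by
  refine ((hasSum_linComb ha hv).mapL (innerSL ℂ (sym ha m))).unique ?_
  convert! hasSum_ite_eq m (v m) using 2 with n
  rw [innerSL_apply_apply, inner_smul_right, orthonormal_iff_ite.1 (orthonormal_sym ha)]
  by_cases h : n = m
  · simp [h]
  · simp [h, Ne.symm h]

theorem hasSum_integral_mul_conj (ha : IsBPSKSymbols P a) {v w : ℤ → ℂ}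
    (hv : Summable fun m => ‖v m‖ ^ 2) (hw : Summable fun m => ‖w m‖ ^ 2) :
    HasSum (fun m => v m * conj (w m)) (∫ ω, linComb ha v ω * conj (linComb ha w ω) ∂P) := by
  rw [← inner_eq_integral]
  convert! (hasSum_linComb ha hv).mapL (innerSL ℂ (linComb ha w)) using 2 with m
  rw [innerSL_apply_apply, inner_smul_right, ← inner_conj_symm, inner_sym_linComb ha hw]

/-- Pairing with the conjugate of `linComb ha v` is a continuous functional on `L²`, so it can be
applied term by term to the other series. -/
theorem hasSum_integral_mul (ha : IsBPSKSymbols P a) {v w : ℤ → ℂ}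
    (hv : Summable fun m => ‖v m‖ ^ 2) (hw : Summable fun m => ‖w m‖ ^ 2) :
    HasSum (fun m => v m * w m) (∫ ω, linComb ha v ω * linComb ha w ω ∂P) := by
  have hc : MemLp (fun ω => conj (linComb ha v ω)) 2 P := (Lp.memLp (linComb ha v)).star
  have hi : ∀ y : Lp ℂ 2 P, inner ℂ hc.toLp y = ∫ ω, linComb ha v ω * y ω ∂P := fun y => by
    rw [inner_eq_integral]
    refine integral_congr_ae ?_
    filter_upwards [hc.coeFn_toLp] with ω h
    rw [h, Complex.conj_conj, mul_comm]
  rw [← hi]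
  convert! (hasSum_linComb ha hw).mapL (innerSL ℂ hc.toLp) using 2 with m
  rw [innerSL_apply_apply, inner_smul_right, hi]
  have : ∫ ω, linComb ha v ω * sym ha m ω ∂P = v m := by
    rw [← inner_sym_linComb ha hv m, inner_eq_integral]
    refine integral_congr_ae ?_
    filter_upwards [coeFn_sym ha m] with ω h
    rw [h, Complex.conj_ofReal]
  rw [this, mul_comm]

theorem norm_sq_linComb (ha : IsBPSKSymbols P a) {v : ℤ → ℂ}
    (hv : Summable fun m => ‖v m‖ ^ 2) : ‖linComb ha v‖ ^ 2 = ∑' m, ‖v m‖ ^ 2 := by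
  have h := hasSum_integral_mul_conj ha hv hv
  rw [← inner_eq_integral, inner_self_eq_norm_sq_to_K] at h
  simp only [Complex.mul_conj'] at h
  have h' : HasSum (fun m => ((‖v m‖ ^ 2 : ℝ) : ℂ)) ((‖linComb ha v‖ ^ 2 : ℝ) : ℂ) := by
    push_cast
    exact h
  exact (Complex.hasSum_ofReal.1 h').tsum_eq.symm

theorem integral_linComb (ha : IsBPSKSymbols P a) {v : ℤ → ℂ}
    (hv : Summable fun m => ‖v m‖ ^ 2) : ∫ ω, linComb ha v ω ∂P = 0 := by
  have hc : MemLp (fun _ : Ω => (1 : ℂ)) 2 P := memLp_const 1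
  have hi : ∀ y : Lp ℂ 2 P, inner ℂ hc.toLp y = ∫ ω, y ω ∂P := fun y => by
    rw [inner_eq_integral]
    refine integral_congr_ae ?_
    filter_upwards [hc.coeFn_toLp] with ω h
    rw [h, map_one, mul_one]
  rw [← hi]
  refine ((hasSum_linComb ha hv).mapL (innerSL ℂ hc.toLp)).unique ?_
  convert! hasSum_zero using 2 with m
  rw [innerSL_apply_apply, inner_smul_right, hi, integral_congr_ae (coeFn_sym ha m),
    ha.integral_eq_zero, mul_zero]

/-! ### Fourth moments -/

theorem coeFn_sum_smul_sym (ha : IsBPSKSymbols P a) (v : ℤ → ℂ) (s : Finset ℤ) :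
    ⇑(∑ m ∈ s, v m • sym ha m) =ᵐ[P] finComb a v s := by
  have h1 : ∀ᵐ ω ∂P, ∀ m, (v m • sym ha m) ω = v m * a m ω := by
    refine ae_all_iff.2 fun m => ?_
    filter_upwards [Lp.coeFn_smul (v m) (sym ha m), coeFn_sym ha m] with ω h1 h2
    rw [h1, Pi.smul_apply, h2, smul_eq_mul]
  filter_upwards [Lp.coeFn_fun_finsetSum s fun m => v m • sym ha m, h1] with ω h2 h3
  rw [h2]
  simp only [h3, finComb]

theorem memLp_finComb_four (ha : IsBPSKSymbols P a) (v : ℤ → ℂ) (s : Finset ℤ) :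
    MemLp (finComb a v s) 4 P :=
  MemLp.of_bound (ha.measurable_finComb v s).aestronglyMeasurable _ (ha.norm_finComb_le v s)

theorem norm_sum_sq_le (v : ℤ → ℂ) (s : Finset ℤ) : ‖∑ m ∈ s, v m ^ 2‖ ≤ ∑ m ∈ s, ‖v m‖ ^ 2 :=
  norm_sum_le_of_le _ fun _ _ => (norm_pow _ _).le

theorem summable_pow_four {v : ℤ → ℂ} (hv : Summable fun m => ‖v m‖ ^ 2) :
    Summable fun m => ‖v m‖ ^ 4 := by
  have h := hv.mul_of_nonneg hv (fun _ => sq_nonneg _) (fun _ => sq_nonneg _)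
  refine (h.comp_injective (i := fun m : ℤ => (m, m)) fun x y h => (Prod.ext_iff.1 h).1).congr
    fun m => ?_
  simp only [Function.comp_apply]
  ring

/-- The series is defined in `L²`, but the moment formula for finite sums bounds the fourth power of
the `L⁴` norm of a block by `3 (∑ |v m|²)²`. Hence it converges in `L⁴` as well, and the formula
passes to the limit. -/
theorem fourth_moment_linComb (ha : IsBPSKSymbols P a) {v : ℤ → ℂ}
    (hv : Summable fun m => ‖v m‖ ^ 2) : MemLp (linComb ha v) 4 P ∧
      ∫ ω, ‖linComb ha v ω‖ ^ 4 ∂P = 2 * (∑' m, ‖v m‖ ^ 2) ^ 2 + ‖∑' m, v m ^ 2‖ ^ 2 -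
        2 * ∑' m, ‖v m‖ ^ 4 := by
  have : Fact ((1 : ℝ≥0∞) ≤ 4) := ⟨by norm_num⟩
  let A : ℤ → Lp ℂ 4 P := fun m => (memLp_finComb_four ha v {m}).toLp
  have hA : ∀ s : Finset ℤ, ⇑(∑ m ∈ s, A m) =ᵐ[P] finComb a v s := by
    intro s
    have h1 : ∀ᵐ ω ∂P, ∀ m, A m ω = v m * a m ω := by
      refine ae_all_iff.2 fun m => ?_
      filter_upwards [(memLp_finComb_four ha v {m}).coeFn_toLp] with ω h1
      rw [h1, finComb, Finset.sum_singleton]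
    filter_upwards [Lp.coeFn_fun_finsetSum s A, h1] with ω h2 h3
    rw [h2]
    simp only [h3, finComb]
  have hN : ∀ s : Finset ℤ, ‖∑ m ∈ s, A m‖ ^ 4 =
      2 * (∑ m ∈ s, ‖v m‖ ^ 2) ^ 2 + ‖∑ m ∈ s, v m ^ 2‖ ^ 2 - 2 * ∑ m ∈ s, ‖v m‖ ^ 4 := by
    intro s
    rw [norm_pow_four_Lp, ← (ha.moments_finComb v s).2.2]
    refine integral_congr_ae ?_
    filter_upwards [hA s] with ω h
    simp only [h]
  have hsA : Summable A := by
    rw [summable_iff_vanishing_norm]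
    intro ε hε
    -- A block of energy below `ε²/2` has fourth moment below `3 ε⁴/4 < ε⁴`.
    obtain ⟨s, hs⟩ := summable_iff_vanishing_norm.1 hv (ε ^ 2 / 2) (by positivity)
    refine ⟨s, fun t ht => lt_of_pow_lt_pow_left₀ 4 hε.le ?_⟩
    have h1 := hs t ht
    have h0 : 0 ≤ ∑ m ∈ t, ‖v m‖ ^ 2 := Finset.sum_nonneg fun _ _ => sq_nonneg _
    rw [Real.norm_of_nonneg h0] at h1
    have h2 := pow_le_pow_left₀ (norm_nonneg _) (norm_sum_sq_le v t) 2
    have h3 := pow_lt_pow_left₀ h1 h0 two_ne_zero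
    have h4 : 0 ≤ ∑ m ∈ t, ‖v m‖ ^ 4 := Finset.sum_nonneg fun _ _ => by positivity
    rw [hN]
    have h5 : (ε ^ 2 / 2) ^ 2 = ε ^ 4 / 4 := by ring
    linarith [sq_nonneg ε, pow_pos hε 4]
  have h2 := tendstoInMeasure_of_tendsto_Lp (hasSum_linComb ha hv)
  have h4 := tendstoInMeasure_of_tendsto_Lp hsA.hasSum
  -- The `L²` and `L⁴` limits agree a.e., both being limits in measure of the same partial sums.
  have hae : linComb ha v =ᵐ[P] (∑' m, A m : Lp ℂ 4 P) := by
    refine tendstoInMeasure_ae_unique h2 (h4.congr (fun s => ?_) (ae_eq_refl _))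
    exact (hA s).trans (coeFn_sum_smul_sym ha v s).symm
  refine ⟨(Lp.memLp (∑' m, A m)).ae_eq hae.symm, ?_⟩
  have e : ∫ ω, ‖linComb ha v ω‖ ^ 4 ∂P = ‖∑' m, A m‖ ^ 4 := by
    rw [norm_pow_four_Lp]
    refine integral_congr_ae ?_
    filter_upwards [hae] with ω h
    simp only [h]
  rw [e]
  have hv2 : Summable fun m => v m ^ 2 := Summable.of_norm (by simpa using hv)
  have hlim : Tendsto (fun s : Finset ℤ => ‖∑ m ∈ s, A m‖ ^ 4) atTop (𝓝 (‖∑' m, A m‖ ^ 4)) :=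
    Tendsto.pow (Tendsto.norm hsA.hasSum) 4
  simp only [hN] at hlim
  refine tendsto_nhds_unique hlim ?_
  exact ((Tendsto.pow hv.hasSum 2).const_mul 2).add (Tendsto.pow (Tendsto.norm hv2.hasSum) 2)
    |>.sub ((summable_pow_four hv).hasSum.const_mul 2)

/-- The subtracted second-order products cancel the Gaussian part of the fourth moment. -/
theorem c4_linComb (ha : IsBPSKSymbols P a) {v : ℤ → ℂ} (hv : Summable fun m => ‖v m‖ ^ 2) :
    c4 P (linComb ha v) = ((-2 * ∑' m, ‖v m‖ ^ 4 : ℝ) : ℂ) := by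
  have h0 := integral_linComb ha hv
  have h0' : ∫ ω, conj (linComb ha v ω) ∂P = 0 := by rw [integral_conj, h0, map_zero]
  have h1 := (hasSum_integral_mul_conj ha hv hv).tsum_eq
  have h2 := (hasSum_integral_mul ha hv hv).tsum_eq
  have h4 := (fourth_moment_linComb ha hv).2
  have e1 : ∫ ω, conj (linComb ha v ω) * linComb ha v ω ∂P =
      ∫ ω, linComb ha v ω * conj (linComb ha v ω) ∂P := by simp only [mul_comm]
  have e2 : ∫ ω, conj (linComb ha v ω) * conj (linComb ha v ω) ∂P =
      conj (∫ ω, linComb ha v ω * linComb ha v ω ∂P) := by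
    rw [← integral_conj]; simp only [map_mul]
  have e4 : ∫ ω, linComb ha v ω * conj (linComb ha v ω) * linComb ha v ω *
      conj (linComb ha v ω) ∂P = ((∫ ω, ‖linComb ha v ω‖ ^ 4 ∂P : ℝ) : ℂ) := by
    rw [← integral_complex_ofReal]
    refine integral_congr_ae (Eventually.of_forall fun ω => ?_)
    simp only
    rw [mul_assoc, Complex.mul_conj']
    push_cast
    ring
  simp only [c4, cum4, h0, h0', sub_zero, e1, e2, e4, h4, ← h1, ← h2]
  simp only [Complex.mul_conj']
  have e5 : (∑' m, (‖v m‖ : ℂ) ^ 2) = ((∑' m, ‖v m‖ ^ 2 : ℝ) : ℂ) := by push_cast; rfl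
  have e6 : ∑' m, v m * v m = ∑' m, v m ^ 2 := by simp only [sq]
  rw [e5, e6]
  push_cast
  ring

theorem c4_symbol (ha : IsBPSKSymbols P a) (n : ℤ) : c4 P (fun ω => (a n ω : ℂ)) = -2 := by
  have h1 := integral_symbol_mul ha n n
  rw [if_pos rfl] at h1
  have h4 : ∫ ω, (a n ω : ℂ) * a n ω * a n ω * a n ω ∂P = 1 := by
    have e : ∀ᵐ ω ∂P, (a n ω : ℂ) * a n ω * a n ω * a n ω = 1 := by
      filter_upwards [ha.ae_eq n] with ω hω
      rcases hω with h | h <;> simp [h]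
    rw [integral_congr_ae e]
    simp
  simp only [c4, cum4, Complex.conj_ofReal, ha.integral_eq_zero, sub_zero, h1, h4]
  norm_num

end Linear

/-! ### Signals with a given received pulse -/

section Pulse

variable {Ω : Type*} [MeasurableSpace Ω] {P : Measure Ω} [IsProbabilityMeasure P] {a : ℤ → Ω → ℝ}
  {T Te : ℝ} {H : ℝ → ℂ}

/-- The sequence `n ↦ ∑_m a_m f(n Te - m T)`, where `f` is the function with spectrum `H`. -/
def pulse (ha : IsBPSKSymbols P a) (T Te : ℝ) (H : ℝ → ℂ) : ℤ → Lp ℂ 2 P :=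
  sampled ha (synth H) T Te

theorem pulse_apply (ha : IsBPSKSymbols P a) (T Te : ℝ) (H : ℝ → ℂ) (n : ℤ) :
    pulse ha T Te H n = linComb ha (fun m => synth H (n * Te - m * T)) := rfl

theorem SpectrumIn.one_mul (hH : SpectrumIn T⁻¹ H) : SpectrumIn ((1 : ℕ) * T⁻¹) H := by
  simpa using hH

theorem SpectrumIn.summable_sq (hH : SpectrumIn T⁻¹ H) (hT : 0 < T) (t : ℝ) :
    Summable fun m : ℤ => ‖synth H (t - m * T)‖ ^ 2 :=
  (summable_sq_synth hT hH.one_mul t).summable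

/-- No harmonic of order at most `3` of the symbol rate is aliased to the zero frequency. -/
def NoAlias (T Te : ℝ) : Prop := ∀ q : ℤ, q ≠ 0 → |q| ≤ 3 → ∀ z : ℤ, q * (Te / T) ≠ z

/-- Here `N = 1`: the spectrum lies in `(-1/T, 1/T)`, so two translates suffice. -/
theorem cycSeq_pulse (ha : IsBPSKSymbols P a) (hT : 0 < T) (hH : SpectrumIn T⁻¹ H) (α : ℝ)
    (m n : ℤ) :
    cycSeq P (pulse ha T Te H) α m n =
      (∑ j ∈ Finset.Ico (-((1 : ℕ) : ℤ)) (1 : ℕ), ∑ j' ∈ Finset.Ico (-((1 : ℕ) : ℤ)) (1 : ℕ),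
        corr T H H (m * Te) j j' * cis ((j - j') * T⁻¹ * (n * Te))) *
          Complex.exp (-(2 * Real.pi * Complex.I * n * α)) := by
  rw [cycSeq, pulse_apply, pulse_apply]
  congr 1
  refine (hasSum_integral_mul_conj ha (hH.summable_sq hT _) (hH.summable_sq hT _)).unique ?_
  have e : ((n + m : ℤ) : ℝ) * Te = n * Te + m * Te := by
    push_cast
    ring
  rw [e]
  exact hasSum_synth_mul_conj hT hH.one_mul hH.one_mul (n * Te) (m * Te)

/-- The product without conjugate is the conjugate product with `conj f`, whose spectrum is `conj (H
(-ν))`. -/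
theorem ncycSeq_pulse (ha : IsBPSKSymbols P a) (hT : 0 < T) (hH : SpectrumIn T⁻¹ H) (α : ℝ)
    (n : ℤ) :
    ncycSeq P (pulse ha T Te H) α 0 n =
      (∑ j ∈ Finset.Ico (-((1 : ℕ) : ℤ)) (1 : ℕ), ∑ j' ∈ Finset.Ico (-((1 : ℕ) : ℤ)) (1 : ℕ),
        corr T H (fun ν => conj (H (-ν))) 0 j j' * cis ((j - j') * T⁻¹ * (n * Te))) *
          Complex.exp (-(2 * Real.pi * Complex.I * n * α)) := by
  rw [ncycSeq, add_zero, pulse_apply]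
  congr 1
  refine (hasSum_integral_mul ha (hH.summable_sq hT _) (hH.summable_sq hT _)).unique ?_
  have h := hasSum_synth_mul_conj hT hH.one_mul hH.conj_neg.one_mul (n * Te) 0
  simpa only [synth_conj_neg, Complex.conj_conj, add_zero] using h

/-- Harmonics of order at most `1`, shifted by `|l| ≤ 1`, involve orders at most `2`. -/
theorem hasTimeAvg_cycSeq (ha : IsBPSKSymbols P a) (hT : 0 < T) (hα : NoAlias T Te)
    (hH : SpectrumIn T⁻¹ H) {l : ℤ} (hl : |l| ≤ 1) :
    HasTimeAvg (cycSeq P (pulse ha T Te H) (l * (Te / T)) 0)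
      ((T⁻¹ : ℝ) * ∫ t, synth H t * conj (synth H t) * cis (-(l * T⁻¹ * t))) := by
  rw [integral_synth_mul_conj hT hH.one_mul hH.one_mul]
  have h := hasTimeAvg_corr (N := 1) H H 0 l fun q hq hq' => hα q hq (by push_cast at hq'; omega)
  convert! h using 2 with n
  rw [cycSeq_pulse ha hT hH]
  simp

/-- At cyclic frequency zero the limit is kept on the spectral side, at every lag: these are the
Fourier coefficients of the spectral density. -/
theorem hasTimeAvg_cycSeq_zero (ha : IsBPSKSymbols P a) (hT : 0 < T) (hα : NoAlias T Te)
    (hH : SpectrumIn T⁻¹ H) (m : ℤ) :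
    HasTimeAvg (cycSeq P (pulse ha T Te H) 0 m)
      ((T⁻¹ : ℝ) * ∫ ν, cis (ν * (m * Te)) * (H ν * conj (H ν))) := by
  rw [← sum_corr_diag hT hH.one_mul hH.memLp]
  have h := hasTimeAvg_corr (N := 1) H H (m * Te) 0 fun q hq hq' =>
    hα q hq (by push_cast at hq'; simp at hq'; omega)
  convert! h using 1
  · funext n
    rw [cycSeq_pulse ha hT hH]
    simp
  · refine Finset.sum_congr rfl fun j hj => ?_
    simp only [sub_eq_zero]
    rw [Finset.sum_ite_eq, if_pos hj]

theorem hasTimeAvg_ncycSeq (ha : IsBPSKSymbols P a) (hT : 0 < T) (hα : NoAlias T Te)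
    (hH : SpectrumIn T⁻¹ H) {l : ℤ} (hl : |l| ≤ 1) :
    HasTimeAvg (ncycSeq P (pulse ha T Te H) (l * (Te / T)) 0)
      ((T⁻¹ : ℝ) * ∫ t, synth H t ^ 2 * cis (-(l * T⁻¹ * t))) := by
  have e := integral_synth_mul_conj hT hH.one_mul hH.conj_neg.one_mul l
  simp only [synth_conj_neg, Complex.conj_conj, ← sq] at e
  rw [e]
  have h := hasTimeAvg_corr (N := 1) H (fun ν => conj (H (-ν))) 0 l fun q hq hq' =>
    hα q hq (by push_cast at hq'; omega)
  convert! h using 2 with n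
  rw [ncycSeq_pulse ha hT hH]

/-- Write `|f|⁴ = |u|²` with `u = |f|²`. The spectrum of `u` lies in the doubled band, so `N = 2`
and harmonics up to order `3` occur; this fixes the bound in `NoAlias`. -/
theorem hasTimeAvg_c4 (ha : IsBPSKSymbols P a) (hT : 0 < T) (hα : NoAlias T Te)
    (hH : SpectrumIn T⁻¹ H) :
    HasTimeAvg (fun n => c4 P (pulse ha T Te H n))
      ((-2 * (T⁻¹ * ∫ t, ‖synth H t‖ ^ 4) : ℝ) : ℂ) := by
  obtain ⟨U, hU, hUs⟩ := hH.exists_mul hH.conj_neg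
  simp only [synth_conj_neg] at hUs
  have hU2 : SpectrumIn ((2 : ℕ) * T⁻¹) U := by exact_mod_cast hU
  have hUn : ∀ t, synth U t * conj (synth U t) = ((‖synth H t‖ ^ 4 : ℝ) : ℂ) := fun t => by
    rw [hUs, Complex.mul_conj', Complex.mul_conj', norm_pow, Complex.norm_real, norm_norm]
    push_cast
    ring
  have e := integral_synth_mul_conj hT hU2 hU2 0
  have h := hasTimeAvg_corr (N := 2) (T := T) (Te := Te) U U 0 0 fun q hq hq' =>
    hα q hq (by push_cast at hq'; simp at hq'; omega)
  rw [← e] at h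
  simp only [hUn, Int.cast_zero, zero_mul, neg_zero, cis_zero, mul_one, integral_complex_ofReal]
    at h
  convert! h.const_mul (-2) using 1
  · funext n
    rw [pulse_apply, c4_linComb ha (hH.summable_sq hT _)]
    have h1 := hasSum_synth_mul_conj hT hU2 hU2 (n * Te) 0
    simp only [add_zero, hUn] at h1
    rw [← h1.tsum_eq]
    push_cast
    simp
  · push_cast
    ring

theorem memLp_four_pulse (ha : IsBPSKSymbols P a) (hT : 0 < T) (hH : SpectrumIn T⁻¹ H) (n : ℤ) :
    MemLp (pulse ha T Te H n) 4 P :=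
  (fourth_moment_linComb ha (hH.summable_sq hT _)).1

theorem avgC4_pulse (ha : IsBPSKSymbols P a) (hT : 0 < T) (hα : NoAlias T Te)
    (hH : SpectrumIn T⁻¹ H) (h1 : ∫ t, ‖synth H t‖ ^ 2 = T) :
    avgC4 P (pulse ha T Te H) = kurtosisFunctional (-2) T (synth H) := by
  rw [avgC4, (hasTimeAvg_c4 ha hT hα hH).timeAvg_eq, Complex.ofReal_re, kurtosisFunctional, h1]
  field_simp

theorem beta_pulse (ha : IsBPSKSymbols P a) (hT : 0 < T) (hα : NoAlias T Te)
    (hH : SpectrumIn T⁻¹ H) (h1 : ∫ t, ‖synth H t‖ ^ 2 = T) :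
    beta P (Te / T) (pulse ha T Te H) = Phi (-2) T (synth H) := by
  have hTn : ‖((T⁻¹ : ℝ) : ℂ)‖ = T⁻¹ := by
    rw [Complex.norm_real, Real.norm_of_nonneg (inv_pos.2 hT).le]
  have c : ∀ l : ℤ, |l| ≤ 1 → cycCorr P (pulse ha T Te H) (l * (Te / T)) 0 = _ := fun l hl =>
    (hasTimeAvg_cycSeq ha hT hα hH hl).timeAvg_eq
  have d : ∀ l : ℤ, |l| ≤ 1 → ncycCorr P (pulse ha T Te H) (l * (Te / T)) 0 = _ := fun l hl =>
    (hasTimeAvg_ncycSeq ha hT hα hH hl).timeAvg_eq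
  have e1 : ∀ t : ℝ, cis (-(((1 : ℤ) : ℝ) * T⁻¹ * t)) =
      Complex.exp (-(2 * Real.pi * Complex.I * (t / T))) := fun t => by
    rw [cis]; push_cast; congr 1; ring
  have e2 : ∀ t : ℝ, cis (-(((-1 : ℤ) : ℝ) * T⁻¹ * t)) =
      Complex.exp (2 * Real.pi * Complex.I * (t / T)) := fun t => by
    rw [cis]; push_cast; congr 1; ring
  have e3 : ∀ t : ℝ, synth H t * conj (synth H t) = ((‖synth H t‖ ^ 2 : ℝ) : ℂ) := fun t => by
    rw [Complex.mul_conj']; push_cast; rfl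
  -- The coefficients for `l = ±1` are conjugate because `|f|²` is real, so the two terms merge into
  -- the coefficient `4` of `Phi`.
  have e4 : ‖∫ t, synth H t * conj (synth H t) * cis (-(((-1 : ℤ) : ℝ) * T⁻¹ * t))‖ =
      ‖∫ t, synth H t * conj (synth H t) * cis (-(((1 : ℤ) : ℝ) * T⁻¹ * t))‖ := by
    rw [← RCLike.norm_conj, ← integral_conj]
    congr 2
    funext t
    simp only [map_mul, Complex.conj_conj, conj_cis]
    push_cast
    ring_nf
  have s1 : ∀ f : ℤ → ℝ, ∑ l ∈ ({-1, 1} : Finset ℤ), f l = f (-1) + f 1 := fun f => by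
    rw [Finset.sum_pair (by decide)]
  have s2 : ∀ f : ℤ → ℝ, ∑ l ∈ ({-1, 0, 1} : Finset ℤ), f l = f (-1) + f 0 + f 1 := fun f => by
    rw [Finset.sum_insert (by decide), Finset.sum_pair (by decide), add_assoc]
  rw [beta, s1, s2, c (-1) (by decide), c 1 (by decide), d (-1) (by decide), d 0 (by decide),
    d 1 (by decide), avgC4_pulse ha hT hα hH h1, Phi, h1]
  simp only [norm_mul, hTn, e4]
  simp only [e1, e2, e3, Int.cast_zero, zero_mul, neg_zero, cis_zero, mul_one]
  ring

/-! ### Linearity and continuity in the spectrum -/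

/-- Continuity of the signal in its spectrum, uniformly in `n`; it controls the passage from finite
impulse responses to general filters. -/
theorem norm_pulse_sq_le (ha : IsBPSKSymbols P a) (hT : 0 < T) (hH : SpectrumIn T⁻¹ H) (n : ℤ) :
    ‖pulse ha T Te H n‖ ^ 2 ≤ T⁻¹ * (2 * ∫ ν, ‖H ν‖ ^ 2) := by
  rw [pulse_apply, norm_sq_linComb ha (hH.summable_sq hT _)]
  simpa using tsum_sq_synth_le hT hH.one_mul (n * Te)

theorem synth_sub {R : ℝ} {K : ℝ → ℂ} (hH : SpectrumIn R H) (hK : SpectrumIn R K) (t : ℝ) :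
    synth (fun ν => H ν - K ν) t = synth H t - synth K t := by
  rw [synth, synth, synth, ← integral_sub (integrable_cis_mul hH.integrable (by fun_prop))
    (integrable_cis_mul hK.integrable (by fun_prop))]
  simp only [mul_sub]

theorem pulse_sub (ha : IsBPSKSymbols P a) (hT : 0 < T) {K : ℝ → ℂ} (hH : SpectrumIn T⁻¹ H)
    (hK : SpectrumIn T⁻¹ K) (n : ℤ) :
    pulse ha T Te (fun ν => H ν - K ν) n = pulse ha T Te H n - pulse ha T Te K n := by
  simp only [pulse_apply, synth_sub hH hK]
  rw [linComb, linComb, linComb, ← (summable_smul_sym ha (hH.summable_sq hT _)).tsum_sub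
    (summable_smul_sym ha (hK.summable_sq hT _))]
  simp only [sub_smul]

end Pulse

/-! ### Trigonometric polynomials -/

theorem coe_circle_exp (x : ℝ) : ((Circle.exp (2 * Real.pi * x) : Circle) : ℂ) = cis x := by
  rw [Circle.coe_exp, cis]
  push_cast
  ring_nf

theorem coe_circle_exp_zpow (x : ℝ) (l : ℤ) :
    (((Circle.exp (2 * Real.pi * x)) ^ l : Circle) : ℂ) = cis (l * x) := by
  rw [Circle.coe_zpow, coe_circle_exp, cis, cis, ← Complex.exp_int_mul]
  push_cast
  ring_nf

theorem firTransfer_exp (c : ℤ →₀ ℂ) (x : ℝ) :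
    firTransfer c (Circle.exp (2 * Real.pi * x)) = c.sum fun l b => b * cis (-(l * x)) := by
  rw [firTransfer]
  refine Finsupp.sum_congr fun l _ => ?_
  rw [coe_circle_exp_zpow]
  push_cast
  rw [neg_mul]

theorem continuous_firTransfer_exp (c : ℤ →₀ ℂ) :
    Continuous fun x : ℝ => firTransfer c (Circle.exp (2 * Real.pi * x)) := by
  simp only [firTransfer_exp, Finsupp.sum]
  fun_prop

theorem exists_firTransfer_approx (φ : C(AddCircle (1 : ℝ), ℂ)) {ε : ℝ} (hε : 0 < ε) :
    ∃ c : ℤ →₀ ℂ, ∀ x : ℝ, ‖φ x - firTransfer c (Circle.exp (2 * Real.pi * x))‖ ≤ ε := by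
  have : Fact ((0 : ℝ) < 1) := ⟨one_pos⟩
  have h1 : φ ∈ (Submodule.span ℂ (Set.range (@fourier 1))).topologicalClosure := by
    rw [span_fourier_closure_eq_top]
    trivial
  rw [← SetLike.mem_coe, Submodule.topologicalClosure_coe, Metric.mem_closure_iff] at h1
  obtain ⟨p, hp, hpε⟩ := h1 ε hε
  -- A tap at delay `l` contributes `z^{-l}`, so the exponentials are reindexed by `l ↦ -l`.
  have h2 : Set.range (@fourier 1) = Set.range (fun l : ℤ => @fourier 1 (-l)) :=
    ((Equiv.neg ℤ).surjective.range_comp _).symm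
  rw [h2, SetLike.mem_coe, Finsupp.mem_span_range_iff_exists_finsupp] at hp
  obtain ⟨c, rfl⟩ := hp
  refine ⟨c, fun x => ?_⟩
  have h3 : firTransfer c (Circle.exp (2 * Real.pi * x)) =
      (c.sum fun l b => b • @fourier 1 (-l) : C(AddCircle (1 : ℝ), ℂ)) x := by
    rw [firTransfer_exp, Finsupp.sum, Finsupp.sum, ContinuousMap.coe_sum, Finset.sum_apply]
    refine Finset.sum_congr rfl fun l _ => ?_
    rw [ContinuousMap.smul_apply, smul_eq_mul, fourier_coe_apply, cis]
    push_cast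
    ring_nf
  rw [h3, ← ContinuousMap.sub_apply]
  refine (ContinuousMap.norm_coe_le_norm _ _).trans ?_
  rw [← dist_eq_norm]
  exact hpε.le

/-- Uniqueness for `L¹`, the natural class for a density. Orthogonality to exponentials extends to
continuous periodic functions by uniform approximation, and then to test functions on the open
period. -/
theorem ae_eq_zero_of_fourier_eq_zero {F : ℝ → ℂ}
    (hF : IntegrableOn F (Set.Ioc (-1 / 2) (1 / 2)))
    (h : ∀ m : ℤ, ∫ ν in Set.Ioc (-1 / 2 : ℝ) (1 / 2), F ν * cis (m * ν) = 0) :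
    ∀ᵐ ν ∂(volume.restrict (Set.Ioc (-1 / 2 : ℝ) (1 / 2))), F ν = 0 := by
  have h1 : ∀ c : ℤ →₀ ℂ, ∫ ν in Set.Ioc (-1 / 2 : ℝ) (1 / 2),
      firTransfer c (Circle.exp (2 * Real.pi * ν)) * F ν = 0 := by
    intro c
    simp only [firTransfer_exp, Finsupp.sum, Finset.sum_mul]
    rw [integral_finsetSum]
    · refine Finset.sum_eq_zero fun l _ => ?_
      have e : ∀ ν : ℝ, c l * cis (-(l * ν)) * F ν = c l * (F ν * cis ((-l : ℤ) * ν)) := fun ν => by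
        push_cast
        rw [neg_mul]
        ring
      simp only [e]
      rw [integral_const_mul, h, mul_zero]
    · intro l _
      simp only [mul_assoc]
      exact (integrable_cis_mul hF (by fun_prop)).const_mul _
  have h2 : ∀ φ : C(AddCircle (1 : ℝ), ℂ),
      ∫ ν in Set.Ioc (-1 / 2 : ℝ) (1 / 2), φ ν * F ν = 0 := by
    intro φ
    rw [← norm_eq_zero]
    have hM : 0 ≤ ∫ ν in Set.Ioc (-1 / 2 : ℝ) (1 / 2), ‖F ν‖ :=
      integral_nonneg fun _ => norm_nonneg _
    refine le_antisymm (le_of_forall_pos_le_add fun ε hε => ?_) (norm_nonneg _)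
    set M := ∫ ν in Set.Ioc (-1 / 2 : ℝ) (1 / 2), ‖F ν‖
    -- Dividing by `M + 1` rather than `M` covers `M = 0`.
    obtain ⟨c, hc⟩ := exists_firTransfer_approx φ (div_pos hε (by linarith : 0 < M + 1))
    have hφ : Integrable (fun ν : ℝ => φ ν * F ν)
        (volume.restrict (Set.Ioc (-1 / 2 : ℝ) (1 / 2))) := by
      refine hF.bdd_mul (c := ‖φ‖) ?_ (Eventually.of_forall fun ν => φ.norm_coe_le_norm _)
      exact (φ.continuous.comp (AddCircle.continuous_mk' 1)).aestronglyMeasurable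
    have hcF : Integrable (fun ν : ℝ => firTransfer c (Circle.exp (2 * Real.pi * ν)) * F ν)
        (volume.restrict (Set.Ioc (-1 / 2 : ℝ) (1 / 2))) := by
      refine hF.bdd_mul (c := ‖φ‖ + ε / (M + 1))
        (continuous_firTransfer_exp c).aestronglyMeasurable (Eventually.of_forall fun ν => ?_)
      have h3 := norm_sub_norm_le (firTransfer c (Circle.exp (2 * Real.pi * ν))) (φ ν)
      rw [norm_sub_rev] at h3
      linarith [hc ν, φ.norm_coe_le_norm (ν : AddCircle (1 : ℝ))]
    rw [← sub_zero (∫ ν in Set.Ioc (-1 / 2 : ℝ) (1 / 2), φ ν * F ν), ← h1 c,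
      ← integral_sub hφ hcF, zero_add]
    refine (norm_integral_le_of_norm_le (hF.norm.const_mul (ε / (M + 1)))
      (Eventually.of_forall fun ν => ?_)).trans ?_
    · rw [← sub_mul, norm_mul]
      exact mul_le_mul_of_nonneg_right (hc ν) (norm_nonneg _)
    · rw [integral_const_mul, div_mul_eq_mul_div, div_le_iff₀ (by linarith)]
      exact mul_le_mul_of_nonneg_left (le_add_of_nonneg_right zero_le_one) hε.le
  have h3 : ∀ᵐ ν : ℝ, ν ∈ Set.Ioo (-1 / 2 : ℝ) (1 / 2) → F ν = 0 := by
    refine isOpen_Ioo.ae_eq_zero_of_integral_contDiff_smul_eq_zero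
      (hF.mono_set Set.Ioo_subset_Ioc_self).locallyIntegrableOn fun g hg _ hgs => ?_
    have : Fact ((0 : ℝ) < 1) := ⟨one_pos⟩
    have hg0 : ∀ x, x ∉ Set.Ioo (-1 / 2 : ℝ) (1 / 2) → g x = 0 := fun x hx =>
      image_eq_zero_of_notMem_tsupport fun h => hx (hgs h)
    have hc : Continuous (AddCircle.liftIoc (1 : ℝ) (-1 / 2) fun x => (g x : ℂ)) := by
      refine AddCircle.liftIoc_continuous ?_
        (Complex.continuous_ofReal.comp hg.continuous).continuousOn
      -- The test function vanishes at both ends of the period, so its periodic extension is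
      -- continuous.
      rw [hg0 _ (by simp), hg0 _ (by norm_num)]
    have h4 := h2 ⟨_, hc⟩
    have h5 : ∫ x, g x • F x = ∫ x in Set.Ioc (-1 / 2 : ℝ) (1 / 2), g x • F x := by
      refine (setIntegral_eq_integral_of_forall_compl_eq_zero fun x hx => ?_).symm
      rw [hg0 x fun h => hx (Set.Ioo_subset_Ioc_self h), zero_smul]
    rw [h5, ← h4]
    refine setIntegral_congr_fun measurableSet_Ioc fun x hx => ?_
    simp only [ContinuousMap.coe_mk]
    rw [AddCircle.liftIoc_coe_apply (by norm_num at hx ⊢; exact hx), Complex.real_smul]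
  rw [← Measure.restrict_congr_set Ioo_ae_eq_Ioc, ae_restrict_iff' measurableSet_Ioo]
  exact h3

/-- Trigonometric polynomials are dense in `L²` of a finite measure carried by a period. -/
theorem exists_firTransfer_eLpNorm_le {μ : Measure ℝ} [IsFiniteMeasure μ]
    (hμ : ∀ᵐ ν ∂μ, ν ∈ Set.Ioc (-1 / 2 : ℝ) (1 / 2)) {F : ℝ → ℂ} (hFm : Measurable F)
    (hF : MemLp F 2 μ) {ε : ℝ≥0∞} (hε : ε ≠ 0) :
    ∃ c : ℤ →₀ ℂ, eLpNorm (fun ν : ℝ => firTransfer c (Circle.exp (2 * Real.pi * ν)) - F ν) 2 μ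
      ≤ ε := by
  have : Fact ((0 : ℝ) < 1) := ⟨one_pos⟩
  have hq : Measurable (fun x : ℝ => (x : AddCircle (1 : ℝ))) :=
    (AddCircle.continuous_mk' 1).measurable
  have hlm : Measurable (AddCircle.liftIoc (1 : ℝ) (-1 / 2) F) :=
    (hFm.comp measurable_subtype_coe).comp (AddCircle.measurableEquivIoc 1 (-1 / 2)).measurable
  have hlF : ∀ᵐ ν : ℝ ∂μ, AddCircle.liftIoc (1 : ℝ) (-1 / 2) F (ν : AddCircle (1 : ℝ)) = F ν := by
    filter_upwards [hμ] with ν hν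
    exact AddCircle.liftIoc_coe_apply (by norm_num at hν ⊢; exact hν)
  have hlp : MemLp (AddCircle.liftIoc (1 : ℝ) (-1 / 2) F) 2
      (μ.map fun x : ℝ => (x : AddCircle (1 : ℝ))) := by
    rw [memLp_map_measure_iff hlm.aestronglyMeasurable hq.aemeasurable]
    refine hF.ae_eq ?_
    filter_upwards [hlF] with ν hν using hν.symm
  obtain ⟨φ, hφ, -⟩ := hlp.exists_boundedContinuous_eLpNorm_sub_le (by norm_num)
    (ε := ε / 2) (ENNReal.half_pos hε).ne'
  rw [eLpNorm_map_measure (hlm.aestronglyMeasurable.sub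
    φ.continuous.aestronglyMeasurable) hq.aemeasurable] at hφ
  -- A uniform error `δ` costs at most `μ(ℝ)^{1/2} δ` in `L²(μ)`, which is small because `μ` is
  -- finite.
  obtain ⟨δ, hδ, hδε⟩ : ∃ δ : ℝ, 0 < δ ∧
      μ Set.univ ^ (2 : ℝ≥0∞).toReal⁻¹ * ENNReal.ofReal δ ≤ ε / 2 := by
    have hfin : μ Set.univ ^ (2 : ℝ≥0∞).toReal⁻¹ ≠ ∞ :=
      ENNReal.rpow_ne_top_of_nonneg (by positivity) (measure_ne_top _ _)
    have ht : Tendsto (fun δ : ℝ => μ Set.univ ^ (2 : ℝ≥0∞).toReal⁻¹ * ENNReal.ofReal δ)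
        (𝓝[>] 0) (𝓝 (μ Set.univ ^ (2 : ℝ≥0∞).toReal⁻¹ * ENNReal.ofReal 0)) :=
      ENNReal.Tendsto.const_mul ((ENNReal.continuous_ofReal.tendsto 0).mono_left
        nhdsWithin_le_nhds) (Or.inr hfin)
    rw [ENNReal.ofReal_zero, mul_zero] at ht
    obtain ⟨δ, h1, h2⟩ := ((ht.eventually (ge_mem_nhds (ENNReal.half_pos hε))).and
      self_mem_nhdsWithin).exists
    exact ⟨δ, h2, h1⟩
  obtain ⟨c, hc⟩ := exists_firTransfer_approx φ.toContinuousMap hδ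
  refine ⟨c, ?_⟩
  have hm1 : AEStronglyMeasurable (fun ν : ℝ => φ (ν : AddCircle (1 : ℝ))) μ :=
    (φ.continuous.measurable.comp hq).aestronglyMeasurable
  have hm2 := (continuous_firTransfer_exp c).aestronglyMeasurable (μ := μ)
  have h1 : eLpNorm (fun ν : ℝ => firTransfer c (Circle.exp (2 * Real.pi * ν)) -
      φ (ν : AddCircle (1 : ℝ))) 2 μ ≤ ε / 2 := by
    refine (eLpNorm_le_of_ae_bound (C := δ) (Eventually.of_forall fun ν => ?_)).trans hδε
    rw [norm_sub_rev]
    exact hc ν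
  have h2 : eLpNorm (fun ν : ℝ => φ (ν : AddCircle (1 : ℝ)) - F ν) 2 μ ≤ ε / 2 := by
    refine le_trans (le_of_eq ?_) hφ
    rw [← eLpNorm_neg]
    refine eLpNorm_congr_ae ?_
    filter_upwards [hlF] with ν hν
    simp [hν]
  calc _ = eLpNorm ((fun ν : ℝ => firTransfer c (Circle.exp (2 * Real.pi * ν)) -
          φ (ν : AddCircle (1 : ℝ))) + fun ν : ℝ => φ (ν : AddCircle (1 : ℝ)) - F ν) 2 μ := by
        congr 1
        funext ν
        simp
    _ ≤ _ := eLpNorm_add_le (hm2.sub hm1) (hm1.sub hF.1) (by norm_num)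
    _ ≤ ε / 2 + ε / 2 := add_le_add h1 h2
    _ = ε := ENNReal.add_halves ε

/-! ### Approximation of filters by finite impulse responses -/

theorem filterNorm_eq_eLpNorm {Ω : Type*} [MeasurableSpace Ω] {P : Measure Ω}
    {x : ℤ → Lp ℂ 2 P} (hx : IsSpectralDensity P x (spectralDensity P x)) (f : Circle → ℂ) :
    filterNorm P x f = eLpNorm (fun ν : ℝ => f (Circle.exp (2 * Real.pi * ν))) 2
      ((volume.restrict (Set.Ioc (-1 / 2 : ℝ) (1 / 2))).withDensity
        fun ν => ENNReal.ofReal (spectralDensity P x ν)) := by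
  rw [eLpNorm_eq_lintegral_rpow_enorm_toReal (by norm_num) (by norm_num),
    lintegral_withDensity_eq_lintegral_mul_non_measurable _ hx.measurable.ennreal_ofReal
      (Eventually.of_forall fun _ => ENNReal.ofReal_lt_top), filterNorm]
  congr 1
  refine lintegral_congr fun ν => ?_
  rw [Pi.mul_apply, ENNReal.toReal_ofNat, ENNReal.rpow_ofNat, ← ofReal_norm,
    ← ENNReal.ofReal_pow (norm_nonneg _), ← ENNReal.ofReal_mul (hx.nonneg ν), mul_comm]

theorem exists_fir_tendsto {Ω : Type*} [MeasurableSpace Ω] {P : Measure Ω}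
    {x : ℤ → Lp ℂ 2 P} (hx : IsSpectralDensity P x (spectralDensity P x)) {f : Circle → ℂ}
    (hf : Measurable fun ν : ℝ => f (Circle.exp (2 * Real.pi * ν)))
    (hfn : filterNorm P x f < ∞) :
    ∃ c : ℕ → ℤ →₀ ℂ,
      Tendsto (fun k => filterNorm P x (fun z => firTransfer (c k) z - f z)) atTop (𝓝 0) := by
  simp only [filterNorm_eq_eLpNorm hx] at hfn ⊢
  have : IsFiniteMeasure ((volume.restrict (Set.Ioc (-1 / 2 : ℝ) (1 / 2))).withDensity
      fun ν => ENNReal.ofReal (spectralDensity P x ν)) :=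
    isFiniteMeasure_withDensity_ofReal hx.integrable.2
  have hμ := (withDensity_absolutelyContinuous (volume.restrict (Set.Ioc (-1 / 2 : ℝ) (1 / 2)))
    fun ν => ENNReal.ofReal (spectralDensity P x ν)).ae_le (ae_restrict_mem measurableSet_Ioc)
  have h := fun k : ℕ => exists_firTransfer_eLpNorm_le hμ hf ⟨hf.aestronglyMeasurable, hfn⟩
    (ε := ((k : ℝ≥0∞) + 1)⁻¹) (by simp)
  choose c hc using h
  refine ⟨c, tendsto_of_tendsto_of_tendsto_of_le_of_le tendsto_const_nhds ?_ (fun _ => zero_le)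
    hc⟩
  have := (tendsto_add_atTop_iff_nat 1).2 ENNReal.tendsto_inv_nat_nhds_zero
  simpa using this

/-! ### Filters applied to the signal with pulse spectrum `G` -/

/-- The standing assumptions on the pulse `G`: its band `[-b, b]` is shorter than both the symbol
rate and the sampling rate, and no low harmonic of the symbol rate is aliased. -/
structure Admissible (T Te b : ℝ) (G : ℝ → ℂ) : Prop where
  T_pos : 0 < T
  Te_pos : 0 < Te
  lt_symbol : b < T⁻¹
  lt_sampling : b < 1 / (2 * Te)
  noAlias : NoAlias T Te
  memLp : MemLp G 2 volume
  eq_zero : ∀ ν, ν ∉ Set.Icc (-b) b → G ν = 0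

theorem spectrumIn_of_band {T b : ℝ} {H : ℝ → ℂ} (hb : b < T⁻¹) (hH : MemLp H 2 volume)
    (h0 : ∀ ν, ν ∉ Set.Icc (-b) b → H ν = 0) : SpectrumIn T⁻¹ H where
  memLp := hH
  eq_zero ν hν := h0 ν fun h => hν ⟨by linarith [h.1], by linarith [h.2]⟩

theorem Admissible.spectrumIn {T Te b : ℝ} {G : ℝ → ℂ} (hA : Admissible T Te b G) :
    SpectrumIn T⁻¹ G :=
  spectrumIn_of_band hA.lt_symbol hA.memLp hA.eq_zero

/-- The spectrum of the pulse at the output of the filter with transfer function `f`. -/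
def filtered (Te : ℝ) (G : ℝ → ℂ) (f : Circle → ℂ) (ξ : ℝ) : ℂ :=
  f (Circle.exp (2 * Real.pi * (Te * ξ))) * G ξ

/-- The spectral density of the signal with pulse spectrum `G`. -/
def pulseDensity (T Te : ℝ) (G : ℝ → ℂ) (ν : ℝ) : ℝ := (T * Te)⁻¹ * ‖G (Te⁻¹ * ν)‖ ^ 2

section

variable {Ω : Type*} [MeasurableSpace Ω] {P : Measure Ω} [IsProbabilityMeasure P] {a : ℤ → Ω → ℝ}
  {T Te b : ℝ} {G : ℝ → ℂ}

/-! ### The spectral density of the pulse signal. -/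

theorem Admissible.eq_zero_of_notMem_Ioc (hA : Admissible T Te b G) {ν : ℝ}
    (hν : ν ∉ Set.Ioc (-1 / 2 : ℝ) (1 / 2)) : G (Te⁻¹ * ν) = 0 := by
  refine hA.eq_zero _ fun h => hν ?_
  have h1 := hA.lt_sampling
  have hTe := hA.Te_pos
  rw [lt_div_iff₀ (by positivity)] at h1
  rw [Set.mem_Icc, inv_mul_eq_div, le_div_iff₀ hTe, div_le_iff₀ hTe] at h
  exact ⟨by linarith [h.1], by linarith [h.2]⟩

theorem quasiMeasurePreserving_mul_left {c : ℝ} (hc : c ≠ 0) :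
    Measure.QuasiMeasurePreserving (fun x : ℝ => c * x) volume volume := by
  refine ⟨by fun_prop, ?_⟩
  rw [Real.map_volume_mul_left hc]
  exact Measure.smul_absolutelyContinuous

theorem Admissible.integrable_pulseDensity (hA : Admissible T Te b G) :
    Integrable (pulseDensity T Te G) :=
  ((hA.memLp.integrable_norm_pow two_ne_zero).comp_mul_left'
    (inv_ne_zero hA.Te_pos.ne')).const_mul _

/-- The band fits in one period of the sampling frequency, so the integral extends to the line and
the substitution `ν = Te ξ` involves no folding. -/
theorem Admissible.integral_pulseDensity (hA : Admissible T Te b G) (m : ℤ) :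
    ∫ ν in Set.Ioc (-1 / 2 : ℝ) (1 / 2), (pulseDensity T Te G ν : ℂ) *
        Complex.exp (2 * Real.pi * Complex.I * m * ν) =
      (T⁻¹ : ℝ) * ∫ ν, cis (ν * (m * Te)) * (G ν * conj (G ν)) := by
  have hTe : Te ≠ 0 := hA.Te_pos.ne'
  rw [setIntegral_eq_integral_of_forall_compl_eq_zero fun ν hν => by
    rw [pulseDensity, hA.eq_zero_of_notMem_Ioc hν]; simp]
  have h := Measure.integral_comp_mul_left
    (fun ξ => ((T * Te : ℝ)⁻¹ : ℂ) * (cis (ξ * (m * Te)) * (G ξ * conj (G ξ)))) Te⁻¹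
  rw [inv_inv, abs_of_pos hA.Te_pos, integral_const_mul] at h
  have e : ∀ ν : ℝ, (pulseDensity T Te G ν : ℂ) * Complex.exp (2 * Real.pi * Complex.I * m * ν) =
      ((T * Te : ℝ)⁻¹ : ℂ) * (cis (Te⁻¹ * ν * (m * Te)) *
        (G (Te⁻¹ * ν) * conj (G (Te⁻¹ * ν)))) := by
    intro ν
    have e1 : Te⁻¹ * ν * (m * Te) = m * ν := by field_simp
    rw [e1, Complex.mul_conj', pulseDensity, cis]
    push_cast
    ring_nf
  have : (Te : ℂ) ≠ 0 := by exact_mod_cast hTe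
  rw [integral_congr_ae (Eventually.of_forall e), integral_const_mul, h, integral_const_mul,
    Complex.real_smul, ← mul_assoc]
  congr 1
  push_cast
  field_simp

theorem Admissible.isSpectralDensity (hA : Admissible T Te b G) (ha : IsBPSKSymbols P a) :
    ∃ S, IsSpectralDensity P (pulse ha T Te G) S := by
  -- A spectral density must be measurable, while `G` is so only up to a null set.
  obtain ⟨G', hG', hGG'⟩ := hA.memLp.1
  have hae : pulseDensity T Te G' =ᵐ[volume] pulseDensity T Te G := by
    have := (quasiMeasurePreserving_mul_left (inv_ne_zero hA.Te_pos.ne')).ae_eq_comp hGG'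
    filter_upwards [this] with ν hν
    simp only [Function.comp_apply] at hν
    rw [pulseDensity, pulseDensity, hν]
  refine ⟨pulseDensity T Te G', ?_, fun ν => ?_, ?_, fun m => ?_⟩
  · have := hG'.measurable
    unfold pulseDensity
    fun_prop
  · have := hA.T_pos
    have := hA.Te_pos
    unfold pulseDensity
    positivity
  · exact (hA.integrable_pulseDensity.congr hae.symm).integrableOn
  · have e : ∫ ν in Set.Ioc (-1 / 2 : ℝ) (1 / 2), (pulseDensity T Te G' ν : ℂ) *
        Complex.exp (2 * Real.pi * Complex.I * m * ν) =
        ∫ ν in Set.Ioc (-1 / 2 : ℝ) (1 / 2), (pulseDensity T Te G ν : ℂ) *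
        Complex.exp (2 * Real.pi * Complex.I * m * ν) := by
      refine integral_congr_ae ?_
      filter_upwards [ae_restrict_of_ae hae] with ν hν
      rw [hν]
    rw [e, hA.integral_pulseDensity]
    exact hasTimeAvg_cycSeq_zero ha hA.T_pos hA.noAlias hA.spectrumIn m

theorem Admissible.spectralDensity_spec (hA : Admissible T Te b G) (ha : IsBPSKSymbols P a) :
    IsSpectralDensity P (pulse ha T Te G) (spectralDensity P (pulse ha T Te G)) := by
  have h := hA.isSpectralDensity ha
  rw [spectralDensity, dif_pos h]
  exact h.choose_spec

/-- Both sides have the same Fourier coefficients, so the chosen version is immaterial. -/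
theorem Admissible.spectralDensity_ae_eq (hA : Admissible T Te b G) (ha : IsBPSKSymbols P a) :
    ∀ᵐ ν ∂(volume.restrict (Set.Ioc (-1 / 2 : ℝ) (1 / 2))),
      spectralDensity P (pulse ha T Te G) ν = pulseDensity T Te G ν := by
  have h := hA.spectralDensity_spec ha
  set S := spectralDensity P (pulse ha T Te G)
  have hi1 : IntegrableOn (fun ν => (S ν : ℂ)) (Set.Ioc (-1 / 2 : ℝ) (1 / 2)) :=
    h.integrable.ofReal
  have hi2 : IntegrableOn (fun ν => (pulseDensity T Te G ν : ℂ)) (Set.Ioc (-1 / 2 : ℝ) (1 / 2)) :=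
    hA.integrable_pulseDensity.ofReal.integrableOn
  have h0 := ae_eq_zero_of_fourier_eq_zero (hi1.sub hi2) fun m => by
    have e : ∀ ν : ℝ, cis (m * ν) = Complex.exp (2 * Real.pi * Complex.I * m * ν) := fun ν => by
      rw [cis]; push_cast; ring_nf
    have h1 := hasTimeAvg_cycSeq_zero ha hA.T_pos hA.noAlias hA.spectrumIn m
    rw [← hA.integral_pulseDensity] at h1
    have h2 := tendsto_nhds_unique (h.hasTimeAvg m) h1
    simp only [Pi.sub_apply, sub_mul]
    rw [integral_sub, sub_eq_zero]
    · simpa only [e] using h2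
    · exact (integrable_cis_mul hi1 (by fun_prop)).congr
        (Eventually.of_forall fun _ => mul_comm _ _)
    · exact (integrable_cis_mul hi2 (by fun_prop)).congr
        (Eventually.of_forall fun _ => mul_comm _ _)
  filter_upwards [h0] with ν hν
  rw [Pi.sub_apply, sub_eq_zero] at hν
  exact_mod_cast hν

/-! ### The filter norm as the energy of the filtered spectrum. -/

theorem lintegral_comp_mul_left {c : ℝ} (hc : 0 < c) (f : ℝ → ℝ≥0∞) :
    ∫⁻ x, f (c * x) = ENNReal.ofReal c⁻¹ * ∫⁻ x, f x := by
  have h := lintegral_map_equiv (μ := volume) f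
    (Homeomorph.mulLeft₀ c hc.ne').toMeasurableEquiv
  have e : ⇑(Homeomorph.mulLeft₀ c hc.ne').toMeasurableEquiv = fun x => c * x := rfl
  rw [e, Real.map_volume_mul_left hc.ne', lintegral_smul_measure, abs_of_pos (inv_pos.2 hc)] at h
  exact h.symm

theorem Admissible.filterNorm_eq (hA : Admissible T Te b G) (ha : IsBPSKSymbols P a)
    (f : Circle → ℂ) :
    filterNorm P (pulse ha T Te G) f =
      (ENNReal.ofReal T⁻¹ * ∫⁻ ξ, ‖filtered Te G f ξ‖ₑ ^ 2) ^ (1 / 2 : ℝ) := by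
  have hT := hA.T_pos
  have hTe := hA.Te_pos
  rw [filterNorm]
  congr 1
  have e1 : ∫⁻ ν in Set.Ioc (-1 / 2 : ℝ) (1 / 2), ENNReal.ofReal
      (‖f (Circle.exp (2 * Real.pi * ν))‖ ^ 2 * spectralDensity P (pulse ha T Te G) ν) =
      ∫⁻ ν in Set.Ioc (-1 / 2 : ℝ) (1 / 2),
        ENNReal.ofReal (T * Te)⁻¹ * ‖filtered Te G f (Te⁻¹ * ν)‖ₑ ^ 2 := by
    refine lintegral_congr_ae ?_
    filter_upwards [hA.spectralDensity_ae_eq ha] with ν hν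
    rw [hν, pulseDensity, filtered, ← ofReal_norm, ← ENNReal.ofReal_pow (norm_nonneg _),
      ← ENNReal.ofReal_mul (by positivity), mul_inv_cancel_left₀ hTe.ne', norm_mul]
    congr 1
    ring
  rw [e1, lintegral_const_mul' _ _ ENNReal.ofReal_ne_top]
  have e2 : ∫⁻ ν in Set.Ioc (-1 / 2 : ℝ) (1 / 2), ‖filtered Te G f (Te⁻¹ * ν)‖ₑ ^ 2 =
      ∫⁻ ν, ‖filtered Te G f (Te⁻¹ * ν)‖ₑ ^ 2 := by
    rw [← lintegral_indicator measurableSet_Ioc]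
    congr 1
    funext ν
    by_cases hν : ν ∈ Set.Ioc (-1 / 2 : ℝ) (1 / 2)
    · rw [Set.indicator_of_mem hν]
    · rw [Set.indicator_of_notMem hν, filtered, hA.eq_zero_of_notMem_Ioc hν]
      simp
  rw [e2, lintegral_comp_mul_left (inv_pos.2 hTe) fun ξ => ‖filtered Te G f ξ‖ₑ ^ 2, inv_inv,
    ← mul_assoc, ← ENNReal.ofReal_mul (by positivity)]
  congr 2
  field_simp

theorem Admissible.aestronglyMeasurable_filtered (hA : Admissible T Te b G) {f : Circle → ℂ}
    (hf : Measurable fun ν : ℝ => f (Circle.exp (2 * Real.pi * ν))) :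
    AEStronglyMeasurable (filtered Te G f) volume := by
  have h : Measurable fun ξ : ℝ => f (Circle.exp (2 * Real.pi * (Te * ξ))) :=
    hf.comp (measurable_const_mul Te)
  exact h.aestronglyMeasurable.mul hA.memLp.1

theorem memLp_two_iff_lintegral {H : ℝ → ℂ} (hH : AEStronglyMeasurable H volume) :
    MemLp H 2 volume ↔ ∫⁻ ξ, ‖H ξ‖ₑ ^ 2 < ∞ := by
  rw [MemLp, eLpNorm_lt_top_iff_lintegral_rpow_enorm_lt_top (by norm_num) (by norm_num)]
  simp [hH]

theorem lintegral_sq_eq_ofReal {H : ℝ → ℂ} (hH : MemLp H 2 volume) :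
    ∫⁻ ξ, ‖H ξ‖ₑ ^ 2 = ENNReal.ofReal (∫ ξ, ‖H ξ‖ ^ 2) := by
  rw [ofReal_integral_eq_lintegral_ofReal (hH.integrable_norm_pow two_ne_zero)
    (Eventually.of_forall fun _ => sq_nonneg _)]
  refine lintegral_congr fun ξ => ?_
  rw [← ofReal_norm, ENNReal.ofReal_pow (norm_nonneg _)]

theorem Admissible.filterNorm_lt_top_iff (hA : Admissible T Te b G) (ha : IsBPSKSymbols P a)
    {f : Circle → ℂ} (hf : Measurable fun ν : ℝ => f (Circle.exp (2 * Real.pi * ν))) :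
    filterNorm P (pulse ha T Te G) f < ∞ ↔ MemLp (filtered Te G f) 2 volume := by
  have hT : 0 < T⁻¹ := inv_pos.2 hA.T_pos
  rw [memLp_two_iff_lintegral (hA.aestronglyMeasurable_filtered hf), hA.filterNorm_eq ha,
    ENNReal.rpow_lt_top_iff_of_pos (by norm_num)]
  refine ⟨fun h => ?_, fun h => ENNReal.mul_lt_top ENNReal.ofReal_lt_top h⟩
  by_contra h1
  rw [not_lt, top_le_iff] at h1
  rw [h1, ENNReal.mul_top (by simpa using hA.T_pos)] at h
  exact lt_irrefl _ h

theorem Admissible.filterNorm_eq_ofReal (hA : Admissible T Te b G) (ha : IsBPSKSymbols P a)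
    {f : Circle → ℂ} (hf : MemLp (filtered Te G f) 2 volume) :
    filterNorm P (pulse ha T Te G) f =
      ENNReal.ofReal (T⁻¹ * ∫ ξ, ‖filtered Te G f ξ‖ ^ 2) ^ (1 / 2 : ℝ) := by
  rw [hA.filterNorm_eq ha, lintegral_sq_eq_ofReal hf,
    ENNReal.ofReal_mul (inv_pos.2 hA.T_pos).le]

theorem Admissible.spectrumIn_filtered (hA : Admissible T Te b G) {f : Circle → ℂ}
    (hf : MemLp (filtered Te G f) 2 volume) : SpectrumIn T⁻¹ (filtered Te G f) :=
  spectrumIn_of_band hA.lt_symbol hf fun ν hν => by rw [filtered, hA.eq_zero ν hν, mul_zero]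

/-! ### Finite impulse responses -/

theorem Admissible.memLp_filtered_fir (hA : Admissible T Te b G) (c : ℤ →₀ ℂ) :
    MemLp (filtered Te G (firTransfer c)) 2 volume := by
  have e : filtered Te G (firTransfer c) =
      fun ξ => ∑ l ∈ c.support, c l * (cis (-(l * (Te * ξ))) * G ξ) := by
    funext ξ
    rw [filtered, firTransfer_exp, Finsupp.sum, Finset.sum_mul]
    simp only [mul_assoc]
  rw [e]
  exact memLp_finsetSum _ fun l _ => (memLp_cis_mul hA.memLp (by fun_prop)).const_mul _

/-- A delay of `l` samples multiplies the spectrum by `e^{-2iπ l Te ξ}`. -/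
theorem Admissible.synth_filtered_fir (hA : Admissible T Te b G) (c : ℤ →₀ ℂ) (t : ℝ) :
    synth (filtered Te G (firTransfer c)) t = ∑ l ∈ c.support, c l * synth G (t - l * Te) := by
  simp only [synth, ← integral_const_mul]
  rw [← integral_finsetSum _ fun l _ =>
    (integrable_cis_mul hA.spectrumIn.integrable (by fun_prop)).const_mul _]
  refine integral_congr_ae (Eventually.of_forall fun ξ => ?_)
  simp only [filtered, firTransfer_exp, Finsupp.sum, Finset.sum_mul, Finset.mul_sum]
  refine Finset.sum_congr rfl fun l _ => ?_
  have : ξ * (t - l * Te) = ξ * t + -(l * (Te * ξ)) := by ring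
  rw [this, cis_add]
  ring

theorem Admissible.firOutput_eq (hA : Admissible T Te b G) (ha : IsBPSKSymbols P a)
    (c : ℤ →₀ ℂ) (n : ℤ) :
    firOutput c (pulse ha T Te G) n = pulse ha T Te (filtered Te G (firTransfer c)) n := by
  rw [firOutput, Finsupp.sum, pulse_apply]
  simp only [hA.synth_filtered_fir, linComb, Finset.sum_smul]
  have hs : ∀ l : ℤ, Summable fun m : ℤ =>
      synth G (n * Te - m * T - l * Te) • sym ha m := fun l => by
    refine (summable_smul_sym ha (hA.spectrumIn.summable_sq hA.T_pos (n * Te - l * Te))).congr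
      fun m => ?_
    rw [sub_right_comm]
  simp only [mul_smul]
  rw [Summable.tsum_finsetSum fun l _ => (hs l).const_smul (c l)]
  refine Finset.sum_congr rfl fun l _ => ?_
  rw [pulse_apply, linComb, (hs l).tsum_const_smul]
  congr 2
  funext m
  congr 2
  push_cast
  ring

/-! ### Outputs of filters -/

/-- The output error is at most `√2` times the filter norm of the error, so all approximating
sequences share one limit. Existence is the density of trigonometric polynomials in `L²` of the
spectral density. -/
theorem Admissible.isFilterOutput_iff (hA : Admissible T Te b G) (ha : IsBPSKSymbols P a)
    {f : Circle → ℂ} (hf : Measurable fun ν : ℝ => f (Circle.exp (2 * Real.pi * ν)))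
    (hfn : filterNorm P (pulse ha T Te G) f < ∞) (r : ℤ → Lp ℂ 2 P) :
    IsFilterOutput P (pulse ha T Te G) f r ↔ r = pulse ha T Te (filtered Te G f) := by
  have hT := hA.T_pos
  have hfL := (hA.filterNorm_lt_top_iff ha hf).1 hfn
  have hfS := hA.spectrumIn_filtered hfL
  have key : ∀ c : ℕ → ℤ →₀ ℂ,
      Tendsto (fun k => filterNorm P (pulse ha T Te G) fun z => firTransfer (c k) z - f z)
        atTop (𝓝 0) →
      ∀ n, Tendsto (fun k => firOutput (c k) (pulse ha T Te G) n) atTop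
        (𝓝 (pulse ha T Te (filtered Te G f) n)) := by
    intro c hc n
    have hd : ∀ k, filtered Te G (fun z => firTransfer (c k) z - f z) =
        fun ξ => filtered Te G (firTransfer (c k)) ξ - filtered Te G f ξ := fun k => by
      funext ξ; simp only [filtered, sub_mul]
    have hdL : ∀ k, MemLp (filtered Te G fun z => firTransfer (c k) z - f z) 2 volume := fun k => by
      rw [hd]; exact (hA.memLp_filtered_fir (c k)).sub hfL
    have h1 : ∀ k, ‖firOutput (c k) (pulse ha T Te G) n - pulse ha T Te (filtered Te G f) n‖ₑ ≤
        ENNReal.ofReal 2 ^ (1 / 2 : ℝ) *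
          filterNorm P (pulse ha T Te G) fun z => firTransfer (c k) z - f z := by
      intro k
      have h2 := norm_pulse_sq_le (Te := Te) ha hT (hA.spectrumIn_filtered (hdL k)) n
      have h3 : firOutput (c k) (pulse ha T Te G) n - pulse ha T Te (filtered Te G f) n =
          pulse ha T Te (filtered Te G fun z => firTransfer (c k) z - f z) n := by
        rw [hA.firOutput_eq ha, hd,
          pulse_sub ha hT (hA.spectrumIn_filtered (hA.memLp_filtered_fir (c k))) hfS]
      rw [hA.filterNorm_eq_ofReal ha (hdL k), h3]
      set I := ∫ ξ, ‖filtered Te G (fun z => firTransfer (c k) z - f z) ξ‖ ^ 2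
      have hI : 0 ≤ T⁻¹ * I :=
        mul_nonneg (inv_pos.2 hT).le (integral_nonneg fun _ => sq_nonneg _)
      rw [← ENNReal.mul_rpow_of_nonneg _ _ (by norm_num), ← ENNReal.ofReal_mul (by norm_num),
        ENNReal.ofReal_rpow_of_nonneg (by linarith) (by norm_num), ← ofReal_norm,
        ← Real.sqrt_eq_rpow]
      refine ENNReal.ofReal_le_ofReal (Real.le_sqrt_of_sq_le (h2.trans_eq ?_))
      ring
    rw [tendsto_iff_edist_tendsto_0]
    simp only [edist_eq_enorm_sub]
    have h5 := ENNReal.Tendsto.const_mul (a := ENNReal.ofReal 2 ^ (1 / 2 : ℝ)) hc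
      (Or.inr (ENNReal.rpow_ne_top_of_nonneg (by norm_num) (by norm_num)))
    rw [mul_zero] at h5
    exact tendsto_of_tendsto_of_tendsto_of_le_of_le tendsto_const_nhds h5 (fun _ => zero_le)
      h1
  constructor
  · rintro ⟨c, hc, hr⟩
    funext n
    exact tendsto_nhds_unique (hr n) (key c hc n)
  · rintro rfl
    obtain ⟨c, hc⟩ := exists_fir_tendsto (hA.spectralDensity_spec ha) hf hfn
    exact ⟨c, hc, key c hc⟩

end

/-! ### The functionals on the space of band-limited functions -/

theorem IsBandSpectrum.eq_synth {B : Set ℝ} {f H : ℝ → ℂ} (h : IsBandSpectrum B f H) :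
    f = synth H := by
  funext t
  rw [h.eq_integral, setIntegral_eq_integral_of_forall_compl_eq_zero fun ν hν => by
    rw [h.eq_zero ν hν, mul_zero], synth]
  simp only [cis]
  push_cast
  simp only [mul_assoc]

theorem isBandSpectrum_synth {T b : ℝ} (hT : 0 < T) (hb : b < T⁻¹) {H : ℝ → ℂ}
    (hH : MemLp H 2 volume) (h0 : ∀ ν, ν ∉ Set.Icc (-b) b → H ν = 0) :
    IsBandSpectrum (Set.Icc (-b) b) (synth H) H where
  memLp := (spectrumIn_of_band hb hH h0).one_mul.memLp_synth hT
  memLp_spectrum := hH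
  eq_zero := h0
  eq_integral t := by
    rw [setIntegral_eq_integral_of_forall_compl_eq_zero fun ν hν => by
      rw [h0 ν hν, mul_zero], synth]
    simp only [cis]
    push_cast
    simp only [mul_assoc]

theorem synth_const_mul (c : ℂ) (H : ℝ → ℂ) : synth (fun ν => c * H ν) = fun t => c * synth H t := by
  funext t
  simp only [synth, ← integral_const_mul]
  congr 1
  funext ν
  ring

theorem Phi_const_mul (κ T : ℝ) {c : ℝ} (hc : 0 < c) (f : ℝ → ℂ) :
    Phi κ T (fun t => c * f t) = Phi κ T f ∧
      kurtosisFunctional κ T (fun t => c * f t) = kurtosisFunctional κ T f := by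
  have hn : ‖(c : ℂ)‖ = c := by rw [Complex.norm_real, Real.norm_of_nonneg hc.le]
  have hk : kurtosisFunctional κ T (fun t => c * f t) = kurtosisFunctional κ T f := by
    simp only [kurtosisFunctional, norm_mul, hn, mul_pow, integral_const_mul]
    congr 1
    rw [← pow_mul, mul_div_mul_left _ _ (by positivity)]
  refine ⟨?_, hk⟩
  rw [Phi, hk, Phi]
  simp only [norm_mul, hn, mul_pow, Complex.ofReal_mul, Complex.ofReal_pow, mul_assoc,
    integral_const_mul, norm_pow]
  rw [mul_div_mul_left _ _ (by positivity)]
  simp only [← pow_mul]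
  rw [mul_div_mul_left _ _ (by positivity), mul_div_mul_left _ _ (by positivity),
    mul_div_mul_left _ _ (by positivity)]

/-- `|f(t)|²` is one term of `∑_m |f(t - mT)|²`, hence at most `2 T⁻¹ ∫|f|²`; multiply by `|f|²` and
integrate. -/
theorem integral_pow_four_le {T : ℝ} (hT : 0 < T) {H : ℝ → ℂ} (hH : SpectrumIn T⁻¹ H) :
    ∫ t, ‖synth H t‖ ^ 4 ≤ 2 * T⁻¹ * (∫ t, ‖synth H t‖ ^ 2) ^ 2 := by
  have hp := plancherel_synth hT hH.one_mul
  have hb : ∀ t, ‖synth H t‖ ^ 2 ≤ 2 * T⁻¹ * ∫ t, ‖synth H t‖ ^ 2 := fun t => by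
    have h1 := (hH.summable_sq hT t).le_tsum 0 fun _ _ => sq_nonneg _
    have h2 := tsum_sq_synth_le hT hH.one_mul t
    rw [hp]
    simp only [Int.cast_zero, zero_mul, sub_zero] at h1
    refine (h1.trans h2).trans_eq ?_
    push_cast
    ring
  have hi := (hH.one_mul.memLp_synth hT).integrable_norm_pow two_ne_zero
  rw [sq (∫ t, ‖synth H t‖ ^ 2), ← mul_assoc, ← integral_const_mul]
  refine integral_mono_of_nonneg (Eventually.of_forall fun t => by positivity) (hi.const_mul _)
    (Eventually.of_forall fun t => ?_)
  have e : ‖synth H t‖ ^ 4 = ‖synth H t‖ ^ 2 * ‖synth H t‖ ^ 2 := by ring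
  simp only [e]
  exact mul_le_mul_of_nonneg_right (hb t) (sq_nonneg _)

theorem neg_four_le_kurtosisFunctional {T : ℝ} (hT : 0 < T) {H : ℝ → ℂ}
    (hH : SpectrumIn T⁻¹ H) : -4 ≤ kurtosisFunctional (-2) T (synth H) := by
  have h1 : (∫ t, ‖synth H t‖ ^ 4) / (∫ t, ‖synth H t‖ ^ 2) ^ 2 ≤ 2 * T⁻¹ :=
    div_le_of_le_mul₀ (sq_nonneg _) (by positivity) (integral_pow_four_le hT hH)
  have h2 := mul_le_mul_of_nonneg_left h1 hT.le
  have h3 : T * (2 * T⁻¹) = 2 := by field_simp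
  rw [kurtosisFunctional]
  linarith

theorem kurtosisFunctional_le_Phi (κ T : ℝ) (f : ℝ → ℂ) : kurtosisFunctional κ T f ≤ Phi κ T f := by
  rw [Phi]
  have h1 : 0 ≤ ‖∫ t, f t ^ 2‖ ^ 2 / (∫ t, ‖f t‖ ^ 2) ^ 2 := by positivity
  have h2 : 0 ≤ ‖∫ t : ℝ, f t ^ 2 * Complex.exp (-(2 * Real.pi * Complex.I * (t / T)))‖ ^ 2
        / (∫ t, ‖f t‖ ^ 2) ^ 2 := by positivity
  have h3 : 0 ≤ ‖∫ t : ℝ, f t ^ 2 * Complex.exp (2 * Real.pi * Complex.I * (t / T))‖ ^ 2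
        / (∫ t, ‖f t‖ ^ 2) ^ 2 := by positivity
  have h4 : 0 ≤ 4 * (‖∫ t : ℝ, ((‖f t‖ ^ 2 : ℝ) : ℂ) *
      Complex.exp (-(2 * Real.pi * Complex.I * (t / T)))‖ / ∫ t, ‖f t‖ ^ 2) ^ 2 := by positivity
  linarith

/-- The spectra of the band-limited functions of energy `T`. -/
def energySphere (T b : ℝ) : Set (ℝ → ℂ) :=
  {H | MemLp H 2 volume ∧ (∀ ν, ν ∉ Set.Icc (-b) b → H ν = 0) ∧ ∫ t, ‖synth H t‖ ^ 2 = T}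

theorem synth_eq_zero_of_integral {T : ℝ} (hT : 0 < T) {H : ℝ → ℂ} (hH : SpectrumIn T⁻¹ H)
    (h : ∫ t, ‖synth H t‖ ^ 2 = 0) : synth H = 0 := by
  rw [plancherel_synth hT hH.one_mul, integral_eq_zero_iff_of_nonneg (fun _ => sq_nonneg _)
    (hH.memLp.integrable_norm_pow two_ne_zero)] at h
  funext t
  refine integral_eq_zero_of_ae ?_
  filter_upwards [h] with ν hν
  simp only [Pi.zero_apply, ne_eq, OfNat.ofNat_ne_zero, not_false_eq_true, pow_eq_zero_iff,
    norm_eq_zero] at hν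
  rw [hν, mul_zero, Pi.zero_apply]

/-- A functional invariant under positive dilations takes the same values on the nonzero
band-limited functions and on those of energy `T`. -/
theorem image_bandLimited_eq {T b : ℝ} (hT : 0 < T) (hb : b < T⁻¹) {Ψ : (ℝ → ℂ) → ℝ}
    (hΨ : ∀ (c : ℝ) (f : ℝ → ℂ), 0 < c → Ψ (fun t => c * f t) = Ψ f) :
    Ψ '' {f | f ∈ bandLimited (Set.Icc (-b) b) ∧ f ≠ 0} =
      (fun H => Ψ (synth H)) '' energySphere T b := by
  ext y
  constructor
  · rintro ⟨f, ⟨⟨H, hfH⟩, hf0⟩, rfl⟩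
    have hf := hfH.eq_synth
    subst hf
    have hH := spectrumIn_of_band hb hfH.memLp_spectrum hfH.eq_zero
    have hpos : 0 < ∫ t, ‖synth H t‖ ^ 2 :=
      (integral_nonneg fun _ => sq_nonneg _).lt_of_ne fun h =>
        hf0 (synth_eq_zero_of_integral hT hH h.symm)
    set I := ∫ t, ‖synth H t‖ ^ 2 with hI
    -- The dilation that brings the energy from `I` to `T`.
    have hc : 0 < √(T / I) := Real.sqrt_pos.2 (div_pos hT hpos)
    refine ⟨fun ν => (√(T / I) : ℂ) * H ν, ⟨hfH.memLp_spectrum.const_mul _, fun ν hν => ?_, ?_⟩, ?_⟩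
    · simp only [hfH.eq_zero ν hν, mul_zero]
    · rw [synth_const_mul]
      simp only [norm_mul, mul_pow, integral_const_mul]
      rw [Complex.norm_real, Real.norm_of_nonneg hc.le, Real.sq_sqrt (div_pos hT hpos).le, ← hI]
      field_simp
    · simp only [synth_const_mul]
      exact hΨ _ _ hc
  · rintro ⟨H, ⟨hH, h0, h1⟩, rfl⟩
    refine ⟨synth H, ⟨⟨H, isBandSpectrum_synth hT hb hH h0⟩, fun h => ?_⟩, rfl⟩
    rw [h] at h1
    simp at h1
    exact hT.ne h1

/-! ### The outputs of the filters of norm one -/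

section

variable {Ω : Type*} [MeasurableSpace Ω] {P : Measure Ω} [IsProbabilityMeasure P] {a : ℤ → Ω → ℝ}
  {T Te b : ℝ} {G : ℝ → ℂ}

theorem Admissible.filterNorm_eq_one_iff (hA : Admissible T Te b G) (ha : IsBPSKSymbols P a)
    {f : Circle → ℂ} (hf : MemLp (filtered Te G f) 2 volume) :
    filterNorm P (pulse ha T Te G) f = 1 ↔ ∫ t, ‖synth (filtered Te G f) t‖ ^ 2 = T := by
  have hT := hA.T_pos
  rw [plancherel_synth hT (hA.spectrumIn_filtered hf).one_mul, hA.filterNorm_eq_ofReal ha hf,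
    ← ENNReal.one_rpow (1 / 2), (ENNReal.rpow_left_injective (by norm_num)).eq_iff,
    ENNReal.ofReal_eq_one, inv_mul_eq_one₀ hT.ne', eq_comm]

/-- Take `f = H / G` read at the frequency `arg z / (2π Te)`. On the band `|Te ξ| < 1/2`, so the
argument recovers `ξ`. Measurable representatives make `f` measurable, at the price of equality only
almost everywhere. -/
theorem Admissible.exists_filter (hA : Admissible T Te b G)
    (hG : ∀ᵐ ν ∂(volume.restrict (Set.Icc (-b) b)), G ν ≠ 0) {H : ℝ → ℂ}
    (hH : MemLp H 2 volume) (h0 : ∀ ν, ν ∉ Set.Icc (-b) b → H ν = 0) :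
    ∃ f : Circle → ℂ, Measurable (fun ν : ℝ => f (Circle.exp (2 * Real.pi * ν))) ∧
      filtered Te G f =ᵐ[volume] H := by
  obtain ⟨G', hG', hGG'⟩ := hA.memLp.1
  obtain ⟨H', hH', hHH'⟩ := hH.1
  have hTe := hA.Te_pos
  refine ⟨fun z => (fun ξ : ℝ => H' ξ / G' ξ) (Complex.arg z / (2 * Real.pi * Te)), ?_, ?_⟩
  · have h1 : Measurable fun ξ : ℝ => H' ξ / G' ξ := hH'.measurable.div hG'.measurable
    have h2 : Measurable fun ν : ℝ =>
        Complex.arg (Circle.exp (2 * Real.pi * ν) : Circle) / (2 * Real.pi * Te) := by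
      refine (Complex.measurable_arg.comp ?_).div_const _
      simp only [coe_circle_exp]
      exact measurable_cis
    exact h1.comp h2
  · filter_upwards [hGG', hHH', (ae_restrict_iff' measurableSet_Icc).1 hG] with ξ h1 h2 h3
    by_cases hξ : ξ ∈ Set.Icc (-b) b
    · have hb := hA.lt_sampling
      rw [lt_div_iff₀ (by positivity)] at hb
      have hpi := Real.pi_pos
      have hup : Te * ξ < 1 / 2 := by nlinarith [hξ.2]
      have hlo : -(1 / 2) < Te * ξ := by nlinarith [hξ.1]
      have e : Complex.arg (Circle.exp (2 * Real.pi * (Te * ξ)) : Circle) =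
          2 * Real.pi * (Te * ξ) := Circle.arg_exp (by nlinarith) (by nlinarith)
      have e2 : 2 * Real.pi * (Te * ξ) / (2 * Real.pi * Te) = ξ := by field_simp
      simp only [filtered, e, e2]
      rw [← h1, ← h2, div_mul_cancel₀ _ (h3 hξ)]
    · rw [filtered, hA.eq_zero ξ hξ, mul_zero, h0 ξ hξ]

theorem synth_congr_ae {H K : ℝ → ℂ} (h : H =ᵐ[volume] K) : synth H = synth K := by
  funext t
  refine integral_congr_ae ?_
  filter_upwards [h] with ν hν
  rw [hν]

/-- The change of variable of the whole proof: an infimum over filters becomes one over spectra. -/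
theorem Admissible.unitNormOutputs_eq (hA : Admissible T Te b G) (ha : IsBPSKSymbols P a)
    (hG : ∀ᵐ ν ∂(volume.restrict (Set.Icc (-b) b)), G ν ≠ 0) :
    unitNormOutputs P (pulse ha T Te G) = pulse ha T Te '' energySphere T b := by
  ext r
  constructor
  · rintro ⟨f, hf, hf1, hr⟩
    have hfn : filterNorm P (pulse ha T Te G) f < ∞ := by rw [hf1]; exact ENNReal.one_lt_top
    have hfL := (hA.filterNorm_lt_top_iff ha hf).1 hfn
    refine ⟨filtered Te G f, ⟨hfL, fun ν hν => ?_, (hA.filterNorm_eq_one_iff ha hfL).1 hf1⟩,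
      ((hA.isFilterOutput_iff ha hf hfn r).1 hr).symm⟩
    rw [filtered, hA.eq_zero ν hν, mul_zero]
  · rintro ⟨H, ⟨hH, h0, h1⟩, rfl⟩
    obtain ⟨f, hf, hfH⟩ := hA.exists_filter hG hH h0
    have hfL : MemLp (filtered Te G f) 2 volume := hH.ae_eq hfH.symm
    have hs := synth_congr_ae hfH
    have hf1 := (hA.filterNorm_eq_one_iff ha hfL).2 (by rw [hs, h1])
    refine ⟨f, hf, hf1,
      (hA.isFilterOutput_iff ha hf (by rw [hf1]; exact ENNReal.one_lt_top) _).2 ?_⟩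
    rw [pulse, pulse, hs]

theorem Admissible.energySphere_nonempty (hA : Admissible T Te b G) (hb0 : 0 < b)
    (hG : ∀ᵐ ν ∂(volume.restrict (Set.Icc (-b) b)), G ν ≠ 0) : (energySphere T b).Nonempty := by
  have hT := hA.T_pos
  have hne : synth G ≠ 0 := fun h => by
    have hp := plancherel_synth hT hA.spectrumIn.one_mul
    rw [h] at hp
    simp only [Pi.zero_apply, norm_zero, ne_eq, OfNat.ofNat_ne_zero, not_false_eq_true, zero_pow,
      integral_zero] at hp
    have h2 := (integral_eq_zero_iff_of_nonneg (fun _ => sq_nonneg _)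
      (hA.memLp.integrable_norm_pow two_ne_zero)).1 hp.symm
    have h3 : ∀ᵐ ν ∂(volume.restrict (Set.Icc (-b) b)), False := by
      filter_upwards [hG, ae_restrict_of_ae h2] with ν h4 h5
      exact h4 (by simpa using h5)
    rw [ae_iff] at h3
    simp only [not_false_eq_true, Set.ofPred_true, Measure.restrict_apply_univ, Real.volume_Icc,
      ENNReal.ofReal_eq_zero] at h3
    linarith
  -- A constant functional serves only to carry nonemptiness from nonzero functions to those of
  -- energy `T`.
  have h := image_bandLimited_eq hT hA.lt_symbol (Ψ := fun _ => 0) fun _ _ _ => rfl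
  have h1 : (0 : ℝ) ∈ (fun _ => (0 : ℝ)) '' {f | f ∈ bandLimited (Set.Icc (-b) b) ∧ f ≠ 0} :=
    ⟨synth G, ⟨⟨G, isBandSpectrum_synth hT hA.lt_symbol hA.memLp hA.eq_zero⟩, hne⟩, rfl⟩
  rw [h] at h1
  obtain ⟨H, hH, -⟩ := h1
  exact ⟨H, hH⟩

end

/-- The sampling condition gives `0 < Te/T < 1`, so `q Te/T = z` with `0 < q ≤ 3` forces `0 < z <
q`, that is `Te/T ∈ {1/2, 1/3, 2/3}`. -/
theorem noAlias_of_notMem {T Te γ : ℝ} (hT : 0 < T) (hγ₀ : 0 < γ) (hTe : 0 < Te)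
    (hShannon : (1 + γ) / (2 * T) < 1 / (2 * Te))
    (hTe' : Te ∉ ({T, T / 2, T / 3, 2 * T / 3} : Set ℝ)) : NoAlias T Te := by
  have hlt : Te / T < 1 := by
    rw [div_lt_div_iff₀ (by positivity) (by positivity)] at hShannon
    rw [div_lt_one hT]
    nlinarith [mul_pos hγ₀ hTe]
  have hpos : 0 < Te / T := div_pos hTe hT
  simp only [Set.mem_insert_iff, Set.mem_singleton_iff, not_or] at hTe'
  obtain ⟨-, h2, h3, h4⟩ := hTe'
  have h2' : Te / T ≠ 1 / 2 := fun h => h2 (by rw [div_eq_iff hT.ne'] at h; linarith)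
  have h3' : Te / T ≠ 1 / 3 := fun h => h3 (by rw [div_eq_iff hT.ne'] at h; linarith)
  have h4' : Te / T ≠ 2 / 3 := fun h => h4 (by rw [div_eq_iff hT.ne'] at h; linarith)
  set α := Te / T
  have key : ∀ q : ℤ, 0 < q → q ≤ 3 → ∀ z : ℤ, (q : ℝ) * α ≠ z := by
    intro q hq hq3 z hz
    have hqr : (0 : ℝ) < q := by exact_mod_cast hq
    have hz0 : (0 : ℝ) < z := by rw [← hz]; positivity
    have hzq : (z : ℝ) < q := by rw [← hz]; nlinarith
    have hz0' : 0 < z := by exact_mod_cast hz0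
    have hzq' : z < q := by exact_mod_cast hzq
    have hcases : (q = 2 ∧ z = 1) ∨ (q = 3 ∧ z = 1) ∨ (q = 3 ∧ z = 2) := by omega
    rcases hcases with ⟨rfl, rfl⟩ | ⟨rfl, rfl⟩ | ⟨rfl, rfl⟩
    · exact h2' (by push_cast at hz; linarith)
    · exact h3' (by push_cast at hz; linarith)
    · exact h4' (by push_cast at hz; linarith)
  intro q hq0 hq3 z hz
  rcases lt_or_gt_of_ne hq0 with h | h
  · refine key (-q) (by omega) (by rw [abs_of_neg h] at hq3; exact hq3) (-z) ?_
    push_cast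
    linarith
  · exact key q h (by rw [abs_of_pos h] at hq3; exact hq3) z hz

end BPSK

end

/-! ### The proposition. -/

theorem mainTheorem3 {Ω : Type*} [MeasurableSpace Ω] (P : Measure Ω) [IsProbabilityMeasure P]
    (a : ℤ → Ω → ℝ) (ha : BPSK.IsBPSKSymbols P a)
    (T γ Te : ℝ) (hT : 0 < T) (hγ₀ : 0 < γ) (hγ₁ : γ < 1)
    (hTe : 0 < Te) (hShannon : (1 + γ) / (2 * T) < 1 / (2 * Te))
    (hTe' : Te ∉ ({T, T / 2, T / 3, 2 * T / 3} : Set ℝ))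
    (g G : ℝ → ℂ) (hg : BPSK.IsBandSpectrum (BPSK.band T γ) g G)
    (hG : ∀ᵐ ν ∂(volume.restrict (BPSK.band T γ)), G ν ≠ 0) :
    -- the kurtosis of the symbols
    (∀ n, BPSK.c4 P (fun ω => (a n ω : ℂ)) = -2) ∧
    -- every filter of finite norm has a well defined output
    (∀ f : Circle → ℂ, Measurable (fun ν : ℝ => f (Circle.exp (2 * Real.pi * ν))) →
      BPSK.filterNorm P (BPSK.sampled ha g T Te) f < ∞ →
      ∃! r, BPSK.IsFilterOutput P (BPSK.sampled ha g T Te) f r) ∧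
    -- the moments and the time averages that define `β` and `<c₄>` exist
    (∀ r ∈ BPSK.unitNormOutputs P (BPSK.sampled ha g T Te),
      (∀ n, MemLp (r n) 4 P) ∧
      (∃ m : ℝ, BPSK.HasTimeAvg (fun n => BPSK.c4 P (r n)) m) ∧
      (∀ l ∈ ({-1, 0, 1} : Finset ℤ),
        (∃ m, BPSK.HasTimeAvg (BPSK.cycSeq P r (l * (Te / T)) 0) m) ∧
        (∃ m, BPSK.HasTimeAvg (BPSK.ncycSeq P r (l * (Te / T)) 0) m))) ∧
    -- the two infima that define and evaluate `β_min` agree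
    (∃ βmin : ℝ,
      IsGLB (BPSK.beta P (Te / T) '' BPSK.unitNormOutputs P (BPSK.sampled ha g T Te)) βmin ∧
      IsGLB (BPSK.Phi (-2) T '' {f | f ∈ BPSK.bandLimited (BPSK.band T γ) ∧ f ≠ 0}) βmin) ∧
    -- the two infima that define and evaluate `η_min` agree
    (∃ ηmin : ℝ,
      IsGLB (BPSK.avgC4 P '' BPSK.unitNormOutputs P (BPSK.sampled ha g T Te)) ηmin ∧
      IsGLB (BPSK.kurtosisFunctional (-2) T ''
        {f | f ∈ BPSK.bandLimited (BPSK.band T γ) ∧ f ≠ 0}) ηmin) := by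
  
  set b := (1 + γ) / (2 * T) with hb
  have hgs : g = BPSK.synth G := hg.eq_synth
  have hA : BPSK.Admissible T Te b G :=
    { T_pos := hT
      Te_pos := hTe
      lt_symbol := by
        -- Here `γ < 1` enters: it keeps the band strictly inside `(-1/T, 1/T)`.
        rw [hb, inv_eq_one_div, div_lt_div_iff₀ (by positivity) hT]
        nlinarith
      lt_sampling := hShannon
      noAlias := BPSK.noAlias_of_notMem hT hγ₀ hTe hShannon hTe'
      memLp := hg.memLp_spectrum
      eq_zero := hg.eq_zero }
  have hx : BPSK.sampled ha g T Te = BPSK.pulse ha T Te G := by rw [hgs]; rfl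
  have hne := hA.energySphere_nonempty (by positivity) hG
  have hU := hA.unitNormOutputs_eq ha hG
  have hS : ∀ H ∈ BPSK.energySphere T b, BPSK.SpectrumIn T⁻¹ H := fun H hH =>
    BPSK.spectrumIn_of_band hA.lt_symbol hH.1 hH.2.1
  -- One argument for both infima. The comparison with the kurtosis functional supplies the common
  -- lower bound `-4`.
  have hglb : ∀ (Ψ : (ℝ → ℂ) → ℝ) (β : (ℤ → Lp ℂ 2 P) → ℝ),
      (∀ (c : ℝ) (f : ℝ → ℂ), 0 < c → Ψ (fun t => c * f t) = Ψ f) →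
      (∀ f, BPSK.kurtosisFunctional (-2) T f ≤ Ψ f) →
      (∀ H ∈ BPSK.energySphere T b, β (BPSK.pulse ha T Te H) = Ψ (BPSK.synth H)) →
      ∃ m : ℝ, IsGLB (β '' (BPSK.pulse ha T Te '' BPSK.energySphere T b)) m ∧
        IsGLB (Ψ '' {f | f ∈ BPSK.bandLimited (BPSK.band T γ) ∧ f ≠ 0}) m := by
    intro Ψ β hΨ hΨk hβ
    have e1 : β '' (BPSK.pulse ha T Te '' BPSK.energySphere T b) =
        (fun H => Ψ (BPSK.synth H)) '' BPSK.energySphere T b := by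
      rw [Set.image_image]
      exact Set.image_congr hβ
    have e2 := BPSK.image_bandLimited_eq hT hA.lt_symbol hΨ
    have hbdd : BddBelow ((fun H => Ψ (BPSK.synth H)) '' BPSK.energySphere T b) := by
      refine ⟨-4, ?_⟩
      rintro _ ⟨H, hH, rfl⟩
      exact (BPSK.neg_four_le_kurtosisFunctional hT (hS H hH)).trans (hΨk _)
    refine ⟨sInf ((fun H => Ψ (BPSK.synth H)) '' BPSK.energySphere T b), ?_, ?_⟩
    · rw [e1]
      exact isGLB_csInf (hne.image _) hbdd
    · rw [BPSK.band, ← hb, e2]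
      exact isGLB_csInf (hne.image _) hbdd
  rw [hx, hU]
  refine ⟨BPSK.c4_symbol ha, fun f hf hfn => ?_, ?_, ?_, ?_⟩
  · exact ⟨_, (hA.isFilterOutput_iff ha hf hfn _).2 rfl,
      fun r hr => (hA.isFilterOutput_iff ha hf hfn r).1 hr⟩
  · rintro _ ⟨H, hH, rfl⟩
    refine ⟨BPSK.memLp_four_pulse ha hT (hS H hH),
      ⟨_, BPSK.hasTimeAvg_c4 ha hT hA.noAlias (hS H hH)⟩, fun l hl => ?_⟩
    have hl1 : |l| ≤ 1 := by
      simp only [Finset.mem_insert, Finset.mem_singleton] at hl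
      rcases hl with rfl | rfl | rfl <;> decide
    exact ⟨⟨_, BPSK.hasTimeAvg_cycSeq ha hT hA.noAlias (hS H hH) hl1⟩,
      ⟨_, BPSK.hasTimeAvg_ncycSeq ha hT hA.noAlias (hS H hH) hl1⟩⟩
  · exact hglb _ _ (fun c f hc => (BPSK.Phi_const_mul _ _ hc f).1)
      (BPSK.kurtosisFunctional_le_Phi _ _)
      fun H hH => BPSK.beta_pulse ha hT hA.noAlias (hS H hH) hH.2.2
  · exact hglb _ _ (fun c f hc => (BPSK.Phi_const_mul _ _ hc f).2) (fun _ => le_rfl)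
      fun H hH => BPSK.avgC4_pulse ha hT hA.noAlias (hS H hH) hH.2.2
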